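/- Notation. $|\cdot|$ is the Euclidean norm (and the induced operator norm). $\mathcal K$: continuous strictly increasing $\delta:[0,\infty)\to[0,\infty)$ with $\delta(0)=0$; $\mathcal K_\infty$: unbounded members of $\mathcal K$; $\mathcal{KL}$: continuous $\beta:[0,\infty)^2\to[0,\infty)$ with $\beta(\cdot,t)\in\mathcal K_\infty$ for every $t$, and $\beta(s,\cdot)$ nonincreasing with limit $0$ for every $s$; $\mathcal M$: functions $N:[0,\infty)\to[0,\infty)$ with $\lim_{\eta\to\infty}\eta N(\eta)=0$. A system $\dot x=F(x,t)$ on $\mathbb R^n$ is forward complete if for all $t_0\ge 0$ and $x_0\in\mathbb R^n$ it has a unique trajectory $\phi(\cdot;t_0,x_0)$ on $[t_0,\infty)$ with $\phi(t_0;t_0,x_0)=x_0$. It is UGAS if it is forward complete and, for some $\beta\in\mathcal{KL}$, $|\phi(t;t_0,x_0)|\le\beta(|x_0|,t-t_0)$ for all $t\ge t_0\ge 0$ and all $x_0$; it is UGES if this holds with $\beta(s,t)=Dse^{-\lambda t}$ for some constants $D>1$, $\lambda>0$. A Lyapunov function for it is a $C^1$ function $V:\mathbb R^n\times[0,\infty)\to[0,\infty)$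 such that, for some $\delta_1,\delta_2\in\mathcal K_\infty$ and $\delta_3\in\mathcal K$, $\delta_1(|\xi|)\le V(\xi,t)\le\delta_2(|\xi|)$ and $V_t(\xi,t)+V_\xi(\xi,t)F(\xi,t)\le-\delta_3(|\xi|)$ for all $\xi\in\mathbb R^n$, $t\ge0$. For $\delta\in\mathcal K$, the system is $\delta$-compatible if it has a Lyapunov function $V$ and there are constants $\bar c\in(0,1)$, $\bar{\bar c}>0$ such that $V_t+V_\xi F\le-\bar c\,\delta(|\xi|)^2$ and $|V_\xi(\xi,t)|\le\delta(|\xi|)$ for all $\xi$ and $t\ge0$, $|F(\xi,t)|\le\delta(|\xi|/2)$ for all $\xi$ and $t\in\mathbb R$, and $\delta(s)\le\bar{\bar c}\,s$ for all $s\ge0$. For a control system $\dot x=F(x,t,u)$, the inputs are the measurable, locally essentially bounded $\mathbf u$ on $[0,\infty)$, trajectories are Carathéodory solutions $\phi(\cdot;t_0,x_0,\mathbf u)$, forward completeness means that for every input, $t_0\ge0$ and $x_0$ there is a unique trajectory on $[t_0,\infty)$, and $|\mathbf u|_{I}$ is the essential supremum of $|\mathbf u|$ on $I$. The control system is ISS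 if it is forward complete and there are $\gamma\in\mathcal K_\infty$, $\beta\in\mathcal{KL}$ with $|\phi(t;t_0,x_0,\mathbf u)|\le\beta(|x_0|,t-t_0)+\gamma(|\mathbf u|_{[t_0,t]})$ for all $t\ge t_0\ge0$, $x_0$, $\mathbf u$; ISES if moreover one can take $\beta(s,t)=Dse^{-\lambda t}$ with $D>1$, $\lambda>0$; iISS if it is forward complete and there are $\mu,\gamma\in\mathcal K_\infty$, $\beta\in\mathcal{KL}$ with $\mu(|\phi(t;t_0,x_0,\mathbf u)|)\le\beta(|x_0|,t-t_0)+\int_{t_0}^{t}\gamma(|\mathbf u(s)|)\,ds$ for all $t\ge t_0\ge0$, $x_0$, $\mathbf u$. Theorem. Let $f:\mathbb R^n\times\mathbb R\times\mathbb R\to\mathbb R^n$ and $\bar f:\mathbb R^n\times\mathbb R\to\mathbb R^n$ be such that, for every $\alpha>0$, the maps $(x,t)\mapsto f(x,t,\alpha t)$ and $(x,t)\mapsto\bar f(x,t)$ are continuous in $t\in\mathbb R$ for fixed $x$ and $C^1$ in $x$ for fixed $t$. Let $\delta\in\mathcal K$, let $\dot x=\bar f(x,t)$ be $\delta$-compatible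 and UGAS, and let $\eta_0>0$, $K>1$, $N\in\mathcal M$ be such that $$\left|\int_{r-1/\eta}^{r+1/\eta}\{f(x,l,\eta^2l)-\bar f(x,l)\}\,dl\right|\le\delta(|x|/2)\,N(\eta)\qquad\forall\,\eta\ge\eta_0,\ x\in\mathbb R^n,\ r\in\mathbb R,$$ $$\left|\tfrac{\partial\bar f}{\partial x}(x,t)\right|\le K,\quad\left|\tfrac{\partial f}{\partial x}(x,t,\alpha t)\right|\le K,\quad|f(x,t,\alpha t)|\le\delta(|x|/2)\qquad\forall\,t\in\mathbb R,\ x\in\mathbb R^n,\ \alpha>0.$$ Then there is $\underline\alpha>0$ such that for all constants $\alpha\ge\underline\alpha$: (i) $\dot x=f(x,t,\alpha t)$ is UGAS and $\dot x=f(x,t,\alpha t)+u$ (with inputs $u$ in $\mathbb R^n$) is iISS; (ii) if in addition $\delta\in\mathcal K_\infty$, then $\dot x=f(x,t,\alpha t)+u$ is ISS; (iii) if $\dot x=\bar f(x,t)$ is UGES, then $\dot x=f(x,t,\alpha t)$ is UGES and $\dot x=f(x,t,\alpha t)+u$ is ISES. -/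

import Mathlib

open MeasureTheory Set Filter Topology

namespace TimeVarying

/-! ### Comparison functions

A function `[0,∞) → [0,∞)` is represented by a function `ℝ → ℝ` of which only the values on
`[0,∞)` are used. -/

/-- Class `K`: continuous and strictly increasing on `[0,∞)`, and zero at zero. -/
structure IsClassK (δ : ℝ → ℝ) : Prop where
  continuousOn : ContinuousOn δ (Ici 0)
  map_zero : δ 0 = 0
  strictMonoOn : StrictMonoOn δ (Ici 0)

/-- Class `K_∞`: class `K` and unbounded. -/
structure IsClassKInfty (δ : ℝ → ℝ) : Prop extends IsClassK δ where
  tendsto_atTop : Tendsto δ atTop atTop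

/-- Class `KL`: continuous on `[0,∞) × [0,∞)`, of class `K_∞` in the first argument, nonincreasing
and convergent to zero in the second. -/
structure IsClassKL (β : ℝ → ℝ → ℝ) : Prop where
  continuousOn : ContinuousOn (fun p : ℝ × ℝ => β p.1 p.2) (Ici 0 ×ˢ Ici 0)
  classKInfty : ∀ t, 0 ≤ t → IsClassKInfty (fun s => β s t)
  antitoneOn : ∀ s, 0 ≤ s → AntitoneOn (β s) (Ici 0)
  tendsto_zero : ∀ s, 0 ≤ s → Tendsto (β s) atTop (𝓝 0)

/-- Class `M`: nonnegative functions on `[0,∞)` with `η N(η) → 0` as `η → ∞`. -/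
structure IsClassM (N : ℝ → ℝ) : Prop where
  nonneg : ∀ η, 0 ≤ η → 0 ≤ N η
  tendsto_zero : Tendsto (fun η => η * N η) atTop (𝓝 0)

/-! ### Systems without inputs -/

/-- `x` is, on `[t₀,∞)`, a trajectory of `ẋ = F(x,t)` with `x(t₀) = x₀`. -/
def IsTrajectory {n : ℕ} (F : EuclideanSpace ℝ (Fin n) → ℝ → EuclideanSpace ℝ (Fin n))
    (t₀ : ℝ) (x₀ : EuclideanSpace ℝ (Fin n)) (x : ℝ → EuclideanSpace ℝ (Fin n)) : Prop :=
  x t₀ = x₀ ∧ ∀ t, t₀ ≤ t → HasDerivWithinAt x (F (x t) t) (Ici t₀) t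

/-- Forward completeness: from every initial state and every initial time `t₀ ≥ 0` there is a
trajectory on `[t₀,∞)`, and it is unique there. -/
def IsForwardComplete {n : ℕ}
    (F : EuclideanSpace ℝ (Fin n) → ℝ → EuclideanSpace ℝ (Fin n)) : Prop :=
  ∀ (t₀ : ℝ) (x₀ : EuclideanSpace ℝ (Fin n)), 0 ≤ t₀ →
    (∃ x, IsTrajectory F t₀ x₀ x) ∧
    ∀ x y, IsTrajectory F t₀ x₀ x → IsTrajectory F t₀ x₀ y → EqOn x y (Ici t₀)

/-- The estimate `|φ(t; t₀, x₀)| ≤ β(|x₀|, t - t₀)` for all `t ≥ t₀ ≥ 0` and all `x₀`. -/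
def StabilityEstimate {n : ℕ}
    (F : EuclideanSpace ℝ (Fin n) → ℝ → EuclideanSpace ℝ (Fin n)) (β : ℝ → ℝ → ℝ) : Prop :=
  ∀ (t₀ : ℝ) (x₀ : EuclideanSpace ℝ (Fin n)) (x : ℝ → EuclideanSpace ℝ (Fin n)), 0 ≤ t₀ →
    IsTrajectory F t₀ x₀ x → ∀ t, t₀ ≤ t → ‖x t‖ ≤ β ‖x₀‖ (t - t₀)

/-- Uniform global asymptotic stability (forward completeness is part of the notion). -/
def IsUGAS {n : ℕ} (F : EuclideanSpace ℝ (Fin n) → ℝ → EuclideanSpace ℝ (Fin n)) : Prop :=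
  IsForwardComplete F ∧ ∃ β : ℝ → ℝ → ℝ, IsClassKL β ∧ StabilityEstimate F β

/-- Uniform global exponential stability (forward completeness is part of the notion). -/
def IsUGES {n : ℕ} (F : EuclideanSpace ℝ (Fin n) → ℝ → EuclideanSpace ℝ (Fin n)) : Prop :=
  IsForwardComplete F ∧ ∃ D lam : ℝ, 1 < D ∧ 0 < lam ∧
    StabilityEstimate F (fun s t => D * s * Real.exp (-lam * t))

/-! ### Lyapunov functions and compatibility -/

/-- The partial derivative `V_t(ξ,t)` of a function on `ℝⁿ × [0,∞)` (one-sided at `t = 0`). -/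
noncomputable def timeDeriv {n : ℕ} (V : EuclideanSpace ℝ (Fin n) → ℝ → ℝ)
    (ξ : EuclideanSpace ℝ (Fin n)) (t : ℝ) : ℝ :=
  derivWithin (fun s => V ξ s) (Ici 0) t

/-- The partial gradient `V_ξ(ξ,t)`, as a linear form. -/
noncomputable def spaceDeriv {n : ℕ} (V : EuclideanSpace ℝ (Fin n) → ℝ → ℝ)
    (ξ : EuclideanSpace ℝ (Fin n)) (t : ℝ) : EuclideanSpace ℝ (Fin n) →L[ℝ] ℝ :=
  fderiv ℝ (fun y => V y t) ξ

/-- `V` is a (strict) Lyapunov function on `ℝⁿ × [0,∞)` for `ẋ = F(x,t)`. -/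
structure IsLyapunov {n : ℕ} (F : EuclideanSpace ℝ (Fin n) → ℝ → EuclideanSpace ℝ (Fin n))
    (V : EuclideanSpace ℝ (Fin n) → ℝ → ℝ) : Prop where
  contDiffOn : ContDiffOn ℝ 1 (fun p : EuclideanSpace ℝ (Fin n) × ℝ => V p.1 p.2)
    (univ ×ˢ Ici 0)
  bounds : ∃ δ₁ δ₂ : ℝ → ℝ, IsClassKInfty δ₁ ∧ IsClassKInfty δ₂ ∧
    ∀ ξ t, 0 ≤ t → δ₁ ‖ξ‖ ≤ V ξ t ∧ V ξ t ≤ δ₂ ‖ξ‖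
  decay : ∃ δ₃ : ℝ → ℝ, IsClassK δ₃ ∧
    ∀ ξ t, 0 ≤ t → timeDeriv V ξ t + spaceDeriv V ξ t (F ξ t) ≤ -δ₃ ‖ξ‖

/-- `δ`-compatibility of `ẋ = F(x,t)`. Conditions on `V` are for `t ≥ 0`, where `V` is defined;
the growth condition on `F` is for all real `t`. -/
def IsCompatible {n : ℕ} (δ : ℝ → ℝ)
    (F : EuclideanSpace ℝ (Fin n) → ℝ → EuclideanSpace ℝ (Fin n)) : Prop :=
  ∃ V : EuclideanSpace ℝ (Fin n) → ℝ → ℝ, IsLyapunov F V ∧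
  ∃ c₁ c₂ : ℝ, 0 < c₁ ∧ c₁ < 1 ∧ 0 < c₂ ∧
    (∀ ξ t, 0 ≤ t → timeDeriv V ξ t + spaceDeriv V ξ t (F ξ t) ≤ -c₁ * δ ‖ξ‖ ^ 2) ∧
    (∀ ξ t, 0 ≤ t → ‖spaceDeriv V ξ t‖ ≤ δ ‖ξ‖) ∧
    (∀ ξ t, ‖F ξ t‖ ≤ δ (‖ξ‖ / 2)) ∧
    (∀ s, 0 ≤ s → δ s ≤ c₂ * s)

/-! ### Control systems -/

/-- Admissible inputs: measurable and locally essentially bounded on `[0,∞)`. -/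
def IsInput {m : ℕ} (u : ℝ → EuclideanSpace ℝ (Fin m)) : Prop :=
  ∀ T : ℝ, MemLp u ⊤ (volume.restrict (Icc 0 T))

/-- The essential supremum of `|u|` over `[a,b]`. -/
noncomputable def essNorm {m : ℕ} (u : ℝ → EuclideanSpace ℝ (Fin m)) (a b : ℝ) : ℝ :=
  (eLpNorm u ⊤ (volume.restrict (Icc a b))).toReal

/-- `x` is, on `[t₀,∞)`, a (Carathéodory) trajectory of `ẋ = F(x,t,u)` for the input `u`, with
`x(t₀) = x₀`: a solution of the integral equation. -/
def IsControlledTrajectory {n m : ℕ}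
    (F : EuclideanSpace ℝ (Fin n) → ℝ → EuclideanSpace ℝ (Fin m) → EuclideanSpace ℝ (Fin n))
    (t₀ : ℝ) (x₀ : EuclideanSpace ℝ (Fin n)) (u : ℝ → EuclideanSpace ℝ (Fin m))
    (x : ℝ → EuclideanSpace ℝ (Fin n)) : Prop :=
  ∀ t, t₀ ≤ t → IntervalIntegrable (fun s => F (x s) s (u s)) volume t₀ t ∧
    x t = x₀ + ∫ s in t₀..t, F (x s) s (u s)

/-- Forward completeness of a control system: for every admissible input, every initial state and
every initial time `t₀ ≥ 0` there is a trajectory on `[t₀,∞)`, and it is unique there. -/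
def IsControlForwardComplete {n m : ℕ}
    (F : EuclideanSpace ℝ (Fin n) → ℝ → EuclideanSpace ℝ (Fin m) → EuclideanSpace ℝ (Fin n)) :
    Prop :=
  ∀ (t₀ : ℝ) (x₀ : EuclideanSpace ℝ (Fin n)) (u : ℝ → EuclideanSpace ℝ (Fin m)), 0 ≤ t₀ →
    IsInput u →
    (∃ x, IsControlledTrajectory F t₀ x₀ u x) ∧
    ∀ x y, IsControlledTrajectory F t₀ x₀ u x → IsControlledTrajectory F t₀ x₀ u y →
      EqOn x y (Ici t₀)

/-- The estimate `|φ(t; t₀, x₀, u)| ≤ β(|x₀|, t - t₀) + γ(|u|_{[t₀,t]})`. -/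
def ISSEstimate {n m : ℕ}
    (F : EuclideanSpace ℝ (Fin n) → ℝ → EuclideanSpace ℝ (Fin m) → EuclideanSpace ℝ (Fin n))
    (β : ℝ → ℝ → ℝ) (γ : ℝ → ℝ) : Prop :=
  ∀ (t₀ : ℝ) (x₀ : EuclideanSpace ℝ (Fin n)) (u : ℝ → EuclideanSpace ℝ (Fin m))
    (x : ℝ → EuclideanSpace ℝ (Fin n)), 0 ≤ t₀ → IsInput u →
    IsControlledTrajectory F t₀ x₀ u x →
    ∀ t, t₀ ≤ t → ‖x t‖ ≤ β ‖x₀‖ (t - t₀) + γ (essNorm u t₀ t)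

/-- Input-to-state stability. -/
def IsISS {n m : ℕ}
    (F : EuclideanSpace ℝ (Fin n) → ℝ → EuclideanSpace ℝ (Fin m) → EuclideanSpace ℝ (Fin n)) :
    Prop :=
  IsControlForwardComplete F ∧ ∃ (γ : ℝ → ℝ) (β : ℝ → ℝ → ℝ),
    IsClassKInfty γ ∧ IsClassKL β ∧ ISSEstimate F β γ

/-- Input-to-state exponential stability. -/
def IsISES {n m : ℕ}
    (F : EuclideanSpace ℝ (Fin n) → ℝ → EuclideanSpace ℝ (Fin m) → EuclideanSpace ℝ (Fin n)) :
    Prop :=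
  IsControlForwardComplete F ∧ ∃ (γ : ℝ → ℝ) (D lam : ℝ),
    IsClassKInfty γ ∧ 1 < D ∧ 0 < lam ∧
    ISSEstimate F (fun s t => D * s * Real.exp (-lam * t)) γ

/-- Integral input-to-state stability. -/
def IsIISS {n m : ℕ}
    (F : EuclideanSpace ℝ (Fin n) → ℝ → EuclideanSpace ℝ (Fin m) → EuclideanSpace ℝ (Fin n)) :
    Prop :=
  IsControlForwardComplete F ∧ ∃ (μ γ : ℝ → ℝ) (β : ℝ → ℝ → ℝ),
    IsClassKInfty μ ∧ IsClassKInfty γ ∧ IsClassKL β ∧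
    ∀ (t₀ : ℝ) (x₀ : EuclideanSpace ℝ (Fin n)) (u : ℝ → EuclideanSpace ℝ (Fin m))
      (x : ℝ → EuclideanSpace ℝ (Fin n)), 0 ≤ t₀ → IsInput u →
      IsControlledTrajectory F t₀ x₀ u x →
      ∀ t, t₀ ≤ t → μ ‖x t‖ ≤ β ‖x₀‖ (t - t₀) + ∫ s in t₀..t, γ ‖u s‖

end TimeVarying

/-! Put `p(x,t) = f(x,t,αt) - fbar(x,t)`, `η = √α`, `h = 2/η`, and change variable to `z = x - h⁻¹
∫_{t-h}^t (l-(t-h)) p(x,l) dl`. At frozen `x` the shift has time derivative `-p(x,t)` plus the mean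
of `p` over `[t-h,t]`: the fast term is traded for its mean, which the averaging hypothesis makes
small since `η N(η) → 0`. The shift is `2Kh`-Lipschitz in `x`, so the motion of `x` contributes only
an error of order `h`. Hence `z` solves `ż = fbar(z,t)` up to an error `ε δ(|z|) + 2|u|`, with `ε`
arbitrarily small for large `α`, while `|x|` and `|z|` agree up to a factor 2
(`isApproxTrajectory_averagingShift`, `exists_approxTrajectory_of_rapid`).

The rest is robustness of the limit system. Along `z` the error adds at most `δ(|z|)(ε δ(|z|) +
2|u|)` to the derivative of `V`; the decay `-c δ(|z|)²` absorbs this up to a multiple of `|u|²`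
(`ae_hasDerivAt_lyapunov_le`), leaving `Ẇ ≤ -σ(W) + C|u|²` for `W = V(z,t)`. Comparison yields iISS
when `σ` is of class `K` and ISS when it is of class `K_∞`. The exponential case uses no Lyapunov
function: over windows of fixed length `z` is compared with the nominal trajectory restarted at `z`
(`exists_exponential_estimate_of_approxTrajectory`). UGAS and UGES are the zero-input cases.

Inputs are only measurable and the shift is only used as a Lipschitz function of `x`, so
differential inequalities hold almost everywhere along Lipschitz curves and are integrated by
absolute continuity. -/

namespace TimeVarying

/-! ### Comparison functions -/

namespace IsClassK

variable {δ : ℝ → ℝ}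

theorem monotoneOn (h : IsClassK δ) : MonotoneOn δ (Ici 0) := h.strictMonoOn.monotoneOn

theorem nonneg (h : IsClassK δ) {s : ℝ} (hs : 0 ≤ s) : 0 ≤ δ s := by
  have := h.monotoneOn (mem_Ici.2 le_rfl) (mem_Ici.2 hs) hs
  rwa [h.map_zero] at this

theorem pos (h : IsClassK δ) {s : ℝ} (hs : 0 < s) : 0 < δ s := by
  have := h.strictMonoOn (mem_Ici.2 le_rfl) (mem_Ici.2 hs.le) hs
  rwa [h.map_zero] at this

theorem comp {ρ : ℝ → ℝ} (h : IsClassK δ) (hρ : IsClassK ρ) : IsClassK (fun s => δ (ρ s)) where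
  continuousOn := h.continuousOn.comp hρ.continuousOn fun _ hs => hρ.nonneg hs
  map_zero := by simp [hρ.map_zero, h.map_zero]
  strictMonoOn := fun _ ha _ hb hab =>
    h.strictMonoOn (hρ.nonneg ha) (hρ.nonneg hb) (hρ.strictMonoOn ha hb hab)

theorem const_mul_sq {c : ℝ} (hc : 0 < c) (h : IsClassK δ) :
    IsClassK (fun s => c * δ s ^ 2) where
  continuousOn := (h.continuousOn.pow 2).const_smul c
  map_zero := by simp [h.map_zero]
  strictMonoOn := fun a ha b hb hab => by
    have h1 := h.strictMonoOn ha hb hab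
    have h2 := h.nonneg ha
    have : δ a ^ 2 < δ b ^ 2 := pow_lt_pow_left₀ h1 h2 two_ne_zero
    exact mul_lt_mul_of_pos_left this hc

theorem add_mul {c : ℝ} (hc : 0 ≤ c) (h : IsClassK δ) :
    IsClassKInfty (fun s => s + c * δ s) where
  continuousOn := continuousOn_id.add (h.continuousOn.const_smul c)
  map_zero := by simp [h.map_zero]
  strictMonoOn := fun a ha b hb hab =>
    add_lt_add_of_lt_of_le hab (mul_le_mul_of_nonneg_left (h.strictMonoOn ha hb hab).le hc)
  tendsto_atTop := by
    refine tendsto_atTop_mono' atTop ?_ tendsto_id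
    filter_upwards [eventually_ge_atTop 0] with s hs
    have := mul_nonneg hc (h.nonneg hs)
    simp only [id]
    linarith

end IsClassK

namespace IsClassKInfty

variable {δ : ℝ → ℝ}

theorem comp {ρ : ℝ → ℝ} (h : IsClassKInfty δ) (hρ : IsClassKInfty ρ) :
    IsClassKInfty (fun s => δ (ρ s)) where
  toIsClassK := h.toIsClassK.comp hρ.toIsClassK
  tendsto_atTop := h.tendsto_atTop.comp hρ.tendsto_atTop

theorem const_mul_sq {c : ℝ} (hc : 0 < c) (h : IsClassKInfty δ) :
    IsClassKInfty (fun s => c * δ s ^ 2) where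
  toIsClassK := h.toIsClassK.const_mul_sq hc
  tendsto_atTop := ((tendsto_pow_atTop two_ne_zero).comp h.tendsto_atTop).const_mul_atTop hc

theorem const_mul {c : ℝ} (hc : 0 < c) (h : IsClassKInfty δ) :
    IsClassKInfty (fun s => c * δ s) where
  continuousOn := h.continuousOn.const_smul c
  map_zero := by simp [h.map_zero]
  strictMonoOn := fun _ ha _ hb hab => mul_lt_mul_of_pos_left (h.strictMonoOn ha hb hab) hc
  tendsto_atTop := h.tendsto_atTop.const_mul_atTop hc

theorem id : IsClassKInfty (fun s => s) where
  continuousOn := continuousOn_id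
  map_zero := rfl
  strictMonoOn := strictMonoOn_id
  tendsto_atTop := tendsto_id

/-- Extended by the identity to the negative axis, `δ` is an increasing bijection of `ℝ`; continuity
and growth of its inverse are then automatic. -/
theorem exists_orderIso (h : IsClassKInfty δ) : ∃ e : ℝ ≃o ℝ, ∀ s, 0 ≤ s → e s = δ s := by
  set g : ℝ → ℝ := fun s => if 0 ≤ s then δ s else s with hg
  have hg1 : ∀ s, 0 ≤ s → g s = δ s := fun s hs => if_pos hs
  have hg2 : ∀ s, s < 0 → g s = s := fun s hs => if_neg hs.not_ge
  have hmono : StrictMono g := by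
    intro a b hab
    rcases lt_or_ge a 0 with ha | ha
    · rw [hg2 a ha]
      rcases lt_or_ge b 0 with hb | hb
      · rwa [hg2 b hb]
      · rw [hg1 b hb]; exact ha.trans_le (h.nonneg hb)
    · rw [hg1 a ha, hg1 b (ha.trans hab.le)]
      exact h.strictMonoOn ha (ha.trans hab.le) hab
  have hsurj : Function.Surjective g := by
    intro y
    rcases lt_or_ge y 0 with hy | hy
    · exact ⟨y, hg2 y hy⟩
    · obtain ⟨M, hM, hM0⟩ :=
        ((h.tendsto_atTop.eventually_ge_atTop y).and (eventually_ge_atTop 0)).exists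
      have := intermediate_value_Icc hM0 (h.continuousOn.mono Icc_subset_Ici_self)
      rw [h.map_zero] at this
      obtain ⟨s, hs, hsy⟩ := this ⟨hy, hM⟩
      exact ⟨s, by rw [hg1 s hs.1, hsy]⟩
  exact ⟨StrictMono.orderIsoOfSurjective g hmono hsurj, fun s hs => hg1 s hs⟩

theorem exists_inverse (h : IsClassKInfty δ) : ∃ g : ℝ → ℝ, IsClassKInfty g ∧
    ∀ s, 0 ≤ s → δ (g s) = s ∧ g (δ s) = s := by
  obtain ⟨e, he⟩ := h.exists_orderIso
  have he0 : e.symm 0 = 0 := by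
    rw [OrderIso.symm_apply_eq, he 0 le_rfl, h.map_zero]
  have hnn : ∀ s, 0 ≤ s → 0 ≤ e.symm s := fun s hs => by
    rw [← he0]; exact e.symm.monotone hs
  refine ⟨e.symm, ⟨⟨e.symm.continuous.continuousOn, he0, e.symm.strictMono.strictMonoOn _⟩,
    e.symm.tendsto_atTop⟩, fun s hs => ⟨?_, ?_⟩⟩
  · rw [← he _ (hnn s hs), OrderIso.apply_symm_apply]
  · rw [← he s hs, OrderIso.symm_apply_apply]

end IsClassKInfty

theorem IsClassKL.comp {β : ℝ → ℝ → ℝ} {ν ρ : ℝ → ℝ} (h : IsClassKL β) (hν : IsClassKInfty ν)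
    (hρ : IsClassKInfty ρ) : IsClassKL (fun s t => ν (β (ρ s) t)) where
  continuousOn := by
    refine hν.continuousOn.comp (h.continuousOn.comp (f := fun p : ℝ × ℝ => (ρ p.1, p.2)) ?_ ?_) ?_
    · exact (hρ.continuousOn.comp continuousOn_fst fun p hp => hp.1).prodMk continuousOn_snd
    · exact fun p hp => ⟨hρ.nonneg hp.1, hp.2⟩
    · exact fun p hp => (h.classKInfty p.2 hp.2).nonneg (hρ.nonneg hp.1)
  classKInfty := fun t ht => hν.comp ((h.classKInfty t ht).comp hρ)
  antitoneOn := fun s hs a ha b hb hab =>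
    hν.monotoneOn ((h.classKInfty b hb).nonneg (hρ.nonneg hs))
      ((h.classKInfty a ha).nonneg (hρ.nonneg hs)) (h.antitoneOn _ (hρ.nonneg hs) ha hb hab)
  tendsto_zero := fun s hs => by
    have h1 := h.tendsto_zero _ (hρ.nonneg hs)
    have h2 : Tendsto ν (𝓝[Ici 0] 0) (𝓝 0) := by
      have := hν.continuousOn 0 (mem_Ici.2 le_rfl)
      rwa [ContinuousWithinAt, hν.map_zero] at this
    refine h2.comp (tendsto_nhdsWithin_iff.2 ⟨h1, ?_⟩)
    filter_upwards [eventually_ge_atTop 0] with t ht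
    exact (h.classKInfty t ht).nonneg (hρ.nonneg hs)

/-- The class `KL` function that governs nonincreasing solutions of `ṗ ≤ -σ(p)`. -/
theorem IsClassK.exists_decay_classKL {σ : ℝ → ℝ} (h : IsClassK σ) :
    ∃ β : ℝ → ℝ → ℝ, IsClassKL β ∧
      ∀ s t r, 0 ≤ s → 0 ≤ t → 0 ≤ r → r + t * σ r ≤ s → r ≤ β s t := by
  -- `β s t` is the root `r` of `r + t σ(r) = s`, that is, the value at `s` of the inverse of a
  -- class `K_∞` function.
  have hex : ∀ t : ℝ, ∃ g : ℝ → ℝ, 0 ≤ t → IsClassKInfty g ∧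
      ∀ s, 0 ≤ s → g s + t * σ (g s) = s ∧ g (s + t * σ s) = s := by
    intro t
    by_cases ht : 0 ≤ t
    · obtain ⟨g, hg, hg'⟩ := (h.add_mul ht).exists_inverse
      exact ⟨g, fun _ => ⟨hg, hg'⟩⟩
    · exact ⟨fun s => s, fun h' => absurd h' ht⟩
  choose g hg using hex
  have hK : ∀ t, 0 ≤ t → IsClassKInfty (g t) := fun t ht => (hg t ht).1
  have heq : ∀ t s, 0 ≤ t → 0 ≤ s → g t s + t * σ (g t s) = s := fun t s ht hs =>
    ((hg t ht).2 s hs).1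
  have hnn : ∀ t s, 0 ≤ t → 0 ≤ s → 0 ≤ g t s := fun t s ht hs => (hK t ht).nonneg hs
  have hle : ∀ t s, 0 ≤ t → 0 ≤ s → g t s ≤ s := fun t s ht hs => by
    have := mul_nonneg ht (h.nonneg (hnn t s ht hs))
    linarith [heq t s ht hs]
  have hroot : ∀ s t r, 0 ≤ s → 0 ≤ t → 0 ≤ r → r + t * σ r ≤ s → r ≤ g t s := by
    intro s t r hs ht hr hrs
    by_contra! hlt
    have h1 := mul_le_mul_of_nonneg_left
      (h.monotoneOn (hnn t s ht hs) (mem_Ici.2 hr) hlt.le) ht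
    linarith [heq t s ht hs]
  have hanti : ∀ s, 0 ≤ s → AntitoneOn (fun t => g t s) (Ici 0) := by
    intro s hs a ha b hb hab
    refine hroot s a _ hs ha (hnn b s hb hs) ?_
    have := mul_le_mul_of_nonneg_right hab (h.nonneg (hnn b s hb hs))
    linarith [heq b s hb hs]
  -- Joint continuity will come from Lipschitz bounds: constant 1 in `s`, and constant `σ s` in `t`.
  have hspace : ∀ t a b, 0 ≤ t → 0 ≤ a → a ≤ b → |g t b - g t a| ≤ b - a := by
    intro t a b ht ha hab
    have hb := ha.trans hab
    have h1 : g t a ≤ g t b := (hK t ht).monotoneOn ha hb hab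
    have h2 := mul_le_mul_of_nonneg_left
      (h.monotoneOn (hnn t a ht ha) (hnn t b ht hb) h1) ht
    rw [abs_of_nonneg (by linarith)]
    linarith [heq t a ht ha, heq t b ht hb]
  have htime : ∀ s a b, 0 ≤ s → 0 ≤ a → a ≤ b → |g b s - g a s| ≤ (b - a) * σ s := by
    intro s a b hs ha hab
    have hb := ha.trans hab
    have h1 : g b s ≤ g a s := hanti s hs ha hb hab
    have h2 := mul_le_mul_of_nonneg_left
      (h.monotoneOn (hnn b s hb hs) (hnn a s ha hs) h1) ha
    have h3 := mul_le_mul_of_nonneg_left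
      (h.monotoneOn (hnn b s hb hs) (mem_Ici.2 hs) (hle b s hb hs)) (sub_nonneg.2 hab)
    rw [abs_sub_comm, abs_of_nonneg (by linarith)]
    linarith [heq a s ha hs, heq b s hb hs]
  have hspace' : ∀ t a b, 0 ≤ t → 0 ≤ a → 0 ≤ b → |g t b - g t a| ≤ |b - a| := by
    intro t a b ht ha hb
    rcases le_total a b with hab | hab
    · rw [abs_of_nonneg (sub_nonneg.2 hab)]; exact hspace t a b ht ha hab
    · rw [abs_sub_comm, abs_sub_comm b a, abs_of_nonneg (sub_nonneg.2 hab)]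
      exact hspace t b a ht hb hab
  have htime' : ∀ s a b, 0 ≤ s → 0 ≤ a → 0 ≤ b → |g b s - g a s| ≤ |b - a| * σ s := by
    intro s a b hs ha hb
    rcases le_total a b with hab | hab
    · rw [abs_of_nonneg (sub_nonneg.2 hab)]; exact htime s a b hs ha hab
    · rw [abs_sub_comm, abs_sub_comm b a, abs_of_nonneg (sub_nonneg.2 hab)]
      exact htime s b a hs hb hab
  refine ⟨fun s t => g t s, ⟨?_, hK, hanti, ?_⟩, hroot⟩
  · rintro ⟨s₀, t₀⟩ ⟨hs₀, ht₀⟩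
    have hs₀' : 0 ≤ s₀ := hs₀
    have ht₀' : 0 ≤ t₀ := ht₀
    rw [ContinuousWithinAt, tendsto_iff_dist_tendsto_zero]
    have hlim : Tendsto (fun p : ℝ × ℝ => |p.1 - s₀| + |p.2 - t₀| * σ s₀)
        (𝓝[Ici 0 ×ˢ Ici 0] (s₀, t₀)) (𝓝 0) := by
      have : Continuous (fun p : ℝ × ℝ => |p.1 - s₀| + |p.2 - t₀| * σ s₀) := by fun_prop
      have h' := (this.tendsto (s₀, t₀)).mono_left (nhdsWithin_le_nhds (s := Ici 0 ×ˢ Ici 0))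
      simpa using h'
    refine squeeze_zero' (Eventually.of_forall fun _ => dist_nonneg) ?_ hlim
    filter_upwards [self_mem_nhdsWithin] with p hp
    have hp1 : 0 ≤ p.1 := hp.1
    have hp2 : 0 ≤ p.2 := hp.2
    calc dist (g p.2 p.1) (g t₀ s₀) ≤ dist (g p.2 p.1) (g p.2 s₀) + dist (g p.2 s₀) (g t₀ s₀) :=
          dist_triangle _ _ _
      _ ≤ _ := add_le_add (hspace' _ _ _ hp2 hs₀' hp1) (htime' _ _ _ hs₀' ht₀' hp2)
  · intro s hs
    rw [Metric.tendsto_atTop]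
    intro ε hε
    have hσ := h.pos hε
    refine ⟨s / σ ε + 1, fun t ht => ?_⟩
    have h0 : 0 ≤ s / σ ε := div_nonneg hs hσ.le
    have ht0 : 0 ≤ t := by linarith
    rw [Real.dist_eq, sub_zero, abs_of_nonneg (hnn t s ht0 hs)]
    by_contra! hcon
    have h1 := mul_le_mul_of_nonneg_left
      (h.monotoneOn (mem_Ici.2 hε.le) (hnn t s ht0 hs) hcon) ht0
    have h2 : s / σ ε * σ ε = s := div_mul_cancel₀ _ hσ.ne'
    have h3 := mul_le_mul_of_nonneg_right ht hσ.le
    have h4 := heq t s ht0 hs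
    have h5 : (s / σ ε + 1) * σ ε = s + σ ε := by rw [_root_.add_mul, h2, one_mul]
    linarith

/-! ### Global existence and uniqueness for globally Lipschitz right-hand sides -/

section GlobalExistence

variable {E : Type*} [NormedAddCommGroup E] [NormedSpace ℝ E]

theorem integral_exp_shift_le {κ a b : ℝ} (hκ : 0 < κ) :
    ∫ s in a..b, Real.exp (κ * (s - a)) ≤ Real.exp (κ * (b - a)) / κ := by
  have hd : ∀ s ∈ uIcc a b,
      HasDerivAt (fun s => Real.exp (κ * (s - a)) / κ) (Real.exp (κ * (s - a))) s := by
    intro s _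
    have h := ((((hasDerivAt_id s).sub_const a).const_mul κ).exp).div_const κ
    simp only [id, mul_one] at h
    rwa [mul_div_cancel_right₀ _ hκ.ne'] at h
  rw [intervalIntegral.integral_eq_sub_of_hasDerivAt hd
    (Continuous.intervalIntegrable (by fun_prop) _ _)]
  have : 0 ≤ Real.exp (κ * (a - a)) / κ := by positivity
  linarith

/-- Picard iteration on the whole half-line at once, for `w = x / ω` in the bounded continuous
functions. The weight `ω` grows fast enough to make the map a contraction and to dominate the
integral of `‖F 0 s‖`. -/
theorem exists_global_integral_solution [CompleteSpace E] {F : E → ℝ → E} {K : ℝ} (hK : 0 < K)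
    (hF : Continuous fun p : E × ℝ => F p.1 p.2)
    (hL : ∀ t x y, ‖F x t - F y t‖ ≤ K * ‖x - y‖) (t₀ : ℝ) (x₀ : E) :
    ∃ x : ℝ → E, Continuous x ∧ ∀ t, t₀ ≤ t → x t = x₀ + ∫ s in t₀..t, F (x s) s := by
  have hc : Continuous fun t : ℝ => max t t₀ := by fun_prop
  have hF0 : Continuous fun s => ‖F 0 s‖ := by fun_prop
  have hprim : ∀ {g : ℝ → ℝ}, Continuous g → Continuous fun t => ∫ s in t₀..max t t₀, g s :=
    fun hg => (intervalIntegral.continuous_primitive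
      (fun a b => hg.intervalIntegrable a b) t₀).comp hc
  have hprimE : ∀ {g : ℝ → E}, Continuous g → Continuous fun t => ∫ s in t₀..max t t₀, g s :=
    fun hg => (intervalIntegral.continuous_primitive
      (fun a b => hg.intervalIntegrable a b) t₀).comp hc
  set m : ℝ → ℝ := fun t => 1 + ∫ s in t₀..max t t₀, ‖F 0 s‖ with hm
  have hmc : Continuous m := continuous_const.add (hprim hF0)
  have hm1 : ∀ t, 1 ≤ m t := fun t => by
    have : 0 ≤ ∫ s in t₀..max t t₀, ‖F 0 s‖ :=
      intervalIntegral.integral_nonneg (le_max_right _ _) fun _ _ => norm_nonneg _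
    simp only [hm]; linarith
  have hmm : ∀ s t, t₀ ≤ s → s ≤ t → m s ≤ m t := fun s t hs hst => by
    simp only [hm, max_eq_left hs, max_eq_left (hs.trans hst)]
    have := intervalIntegral.integral_mono_interval (μ := volume) (f := fun s => ‖F 0 s‖)
      le_rfl hs hst (Eventually.of_forall fun _ => norm_nonneg _)
      (hF0.intervalIntegrable _ _)
    linarith
  -- The rate `2K` gives `∫ ω ≤ ω / (2K)`, hence contraction constant 1/2. Taking `max t t₀` freezes
  -- everything before `t₀`, so that functions live on all of `ℝ`.
  set ω : ℝ → ℝ := fun t => Real.exp (2 * K * (max t t₀ - t₀)) * m t with hω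
  have hωc : Continuous ω := by simp only [hω]; fun_prop
  have hω1 : ∀ t, 1 ≤ ω t := fun t => by
    have h1 : 1 ≤ Real.exp (2 * K * (max t t₀ - t₀)) := Real.one_le_exp
      (mul_nonneg (by linarith) (sub_nonneg.2 (le_max_right _ _)))
    exact one_le_mul_of_one_le_of_one_le h1 (hm1 t)
  have hωm : ∀ t, m t ≤ ω t := fun t => by
    have h1 : 1 ≤ Real.exp (2 * K * (max t t₀ - t₀)) := Real.one_le_exp
      (mul_nonneg (by linarith) (sub_nonneg.2 (le_max_right _ _)))
    exact le_mul_of_one_le_left (by linarith [hm1 t]) h1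
  have hω0 : ∀ t, 0 < ω t := fun t => by linarith [hω1 t]
  have hωint : ∀ t, ∫ s in t₀..max t t₀, ω s ≤ ω t / (2 * K) := fun t => by
    have hle : t₀ ≤ max t t₀ := le_max_right _ _
    calc ∫ s in t₀..max t t₀, ω s
        ≤ ∫ s in t₀..max t t₀, Real.exp (2 * K * (s - t₀)) * m t := by
          refine intervalIntegral.integral_mono_on hle (hωc.intervalIntegrable _ _)
            (Continuous.intervalIntegrable (by fun_prop) _ _) fun s hs => ?_
          simp only [hω, max_eq_left hs.1]
          refine mul_le_mul_of_nonneg_left ?_ (Real.exp_pos _).le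
          have h1 := hmm s _ hs.1 hs.2
          have h2 : m (max t t₀) = m t := by simp [hm]
          rwa [h2] at h1
      _ = (∫ s in t₀..max t t₀, Real.exp (2 * K * (s - t₀))) * m t :=
          intervalIntegral.integral_mul_const _ _
      _ ≤ Real.exp (2 * K * (max t t₀ - t₀)) / (2 * K) * m t :=
          mul_le_mul_of_nonneg_right (integral_exp_shift_le (by linarith)) (by linarith [hm1 t])
      _ = ω t / (2 * K) := by simp only [hω]; ring
  have hdiff : ∀ (w w' : ℝ → E) (d : ℝ), Continuous w → Continuous w' →
      (∀ s, ‖w s - w' s‖ ≤ d) → ∀ t,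
      ‖(∫ s in t₀..max t t₀, F (ω s • w s) s) - ∫ s in t₀..max t t₀, F (ω s • w' s) s‖
        ≤ ω t * (d / 2) := by
    intro w w' d hw hw' hd t
    have hle : t₀ ≤ max t t₀ := le_max_right _ _
    have hd0 : 0 ≤ d := (norm_nonneg _).trans (hd 0)
    rw [← intervalIntegral.integral_sub (Continuous.intervalIntegrable (by fun_prop) _ _)
      (Continuous.intervalIntegrable (by fun_prop) _ _)]
    calc _ ≤ ∫ s in t₀..max t t₀, K * d * ω s := by
          refine intervalIntegral.norm_integral_le_of_norm_le hle
            (Eventually.of_forall fun s _ => ?_)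
            (Continuous.intervalIntegrable (by fun_prop) _ _)
          refine (hL _ _ _).trans ?_
          rw [← smul_sub, norm_smul, Real.norm_of_nonneg (hω0 s).le]
          have := mul_le_mul_of_nonneg_left (hd s) (mul_nonneg hK.le (hω0 s).le)
          linarith
      _ = K * d * ∫ s in t₀..max t t₀, ω s := intervalIntegral.integral_const_mul _ _
      _ ≤ K * d * (ω t / (2 * K)) := mul_le_mul_of_nonneg_left (hωint t) (by positivity)
      _ = ω t * (d / 2) := by field_simp
  have hcont : ∀ w : ℝ → E, Continuous w → Continuous fun t =>
      (ω t)⁻¹ • (x₀ + ∫ s in t₀..max t t₀, F (ω s • w s) s) := fun w hw =>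
    (hωc.inv₀ fun t => (hω0 t).ne').smul (continuous_const.add (hprimE (by fun_prop)))
  let P : BoundedContinuousFunction ℝ E → BoundedContinuousFunction ℝ E := fun w =>
    BoundedContinuousFunction.ofNormedAddCommGroup
      (fun t => (ω t)⁻¹ • (x₀ + ∫ s in t₀..max t t₀, F (ω s • w s) s))
      (hcont w w.continuous) (‖x₀‖ + (1 + ‖w‖ / 2)) (by
        intro t
        have h1 := hdiff w (fun _ => 0) ‖w‖ w.continuous continuous_const
          (fun s => by simpa using w.norm_coe_le_norm s) t
        simp only [smul_zero] at h1
        have h2 : ‖∫ s in t₀..max t t₀, F 0 s‖ ≤ ω t := by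
          refine (intervalIntegral.norm_integral_le_integral_norm (le_max_right _ _)).trans ?_
          have := hωm t
          simp only [hm] at this
          linarith
        have h3 : ‖∫ s in t₀..max t t₀, F (ω s • w s) s‖ ≤ ω t * (‖w‖ / 2) + ω t := by
          have := norm_sub_norm_le (∫ s in t₀..max t t₀, F (ω s • w s) s)
            (∫ s in t₀..max t t₀, F 0 s)
          linarith
        have h4 : ‖x₀‖ ≤ ω t * ‖x₀‖ := le_mul_of_one_le_left (norm_nonneg _) (hω1 t)
        rw [norm_smul, norm_inv, Real.norm_of_nonneg (hω0 t).le, inv_mul_le_iff₀ (hω0 t)]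
        refine (norm_add_le _ _).trans ?_
        linarith)
  have hP : ContractingWith (1 / 2) P := by
    refine ⟨by norm_num, LipschitzWith.of_dist_le_mul fun w w' => ?_⟩
    refine (BoundedContinuousFunction.dist_le (by positivity)).2 fun t => ?_
    have h1 := hdiff w w' (dist w w') w.continuous w'.continuous
      (fun s => by rw [← dist_eq_norm]; exact BoundedContinuousFunction.dist_coe_le_dist s) t
    change dist ((ω t)⁻¹ • (x₀ + ∫ s in t₀..max t t₀, F (ω s • w s) s))
      ((ω t)⁻¹ • (x₀ + ∫ s in t₀..max t t₀, F (ω s • w' s) s)) ≤ _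
    rw [dist_eq_norm, ← smul_sub, add_sub_add_left_eq_sub, norm_smul, norm_inv,
      Real.norm_of_nonneg (hω0 t).le, inv_mul_le_iff₀ (hω0 t)]
    refine h1.trans (le_of_eq ?_)
    push_cast
    ring
  set w := hP.fixedPoint P with hw
  have hfix : P w = w := hP.fixedPoint_isFixedPt
  refine ⟨fun t => ω t • w t, by fun_prop, fun t ht => ?_⟩
  have h1 : (ω t)⁻¹ • (x₀ + ∫ s in t₀..max t t₀, F (ω s • w s) s) = w t :=
    congrArg (fun v : BoundedContinuousFunction ℝ E => v t) hfix
  change ω t • w t = _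
  rw [← h1, smul_smul, mul_inv_cancel₀ (hω0 t).ne', one_smul, max_eq_left ht]

theorem eq_zero_of_integral_eq [CompleteSpace E] {e g : ℝ → E} {K a b : ℝ}
    (hg : ContinuousOn g (Icc a b)) (he : ∀ t ∈ Icc a b, e t = ∫ s in a..t, g s)
    (hb : ∀ t ∈ Icc a b, ‖g t‖ ≤ K * ‖e t‖) : ∀ t ∈ Icc a b, e t = 0 := by
  rcases lt_or_ge b a with hab | hab
  · intro t ht; exact absurd (ht.1.trans ht.2) hab.not_ge
  set g' : ℝ → E := IccExtend hab (domRestrict (Icc a b) g) with hg'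
  have hg'c : Continuous g' := by
    rw [hg', continuous_IccExtend_iff]; exact hg.domRestrict
  have hgg : ∀ t ∈ Icc a b, g' t = g t := fun t ht => IccExtend_of_mem hab _ ht
  have he' : ∀ t ∈ Icc a b, e t = ∫ s in a..t, g' s := fun t ht => by
    rw [he t ht]
    refine intervalIntegral.integral_congr fun s hs => ?_
    rw [uIcc_of_le ht.1] at hs
    exact (hgg s ⟨hs.1, hs.2.trans ht.2⟩).symm
  intro t ht
  rw [he' t ht]
  refine eq_zero_of_abs_deriv_le_mul_abs_self_of_eq_zero_right
    (f := fun t => ∫ s in a..t, g' s) (f' := g') (K := K) (a := a) (b := b) ?_ ?_ ?_ ?_ t ht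
  · exact (intervalIntegral.continuous_primitive
      (fun a b => hg'c.intervalIntegrable a b) a).continuousOn
  · intro s hs
    exact (intervalIntegral.integral_hasDerivAt_right (hg'c.intervalIntegrable _ _)
      (hg'c.stronglyMeasurableAtFilter _ _) hg'c.continuousAt).hasDerivWithinAt
  · simp
  · intro s hs
    have hs' := Ico_subset_Icc_self hs
    rw [hgg s hs', ← he' s hs']
    exact hb s hs'

end GlobalExistence

/-! ### Forward completeness of Lipschitz systems with additive input -/

section Systems

variable {n : ℕ}

theorem IsInput.intervalIntegrable {m : ℕ} {u : ℝ → EuclideanSpace ℝ (Fin m)} (hu : IsInput u)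
    {a b : ℝ} (ha : 0 ≤ a) (hab : a ≤ b) : IntervalIntegrable u volume a b := by
  have h1 : IntegrableOn u (Icc 0 b) := (hu b).integrable le_top
  rw [intervalIntegrable_iff_integrableOn_Icc_of_le hab]
  exact h1.mono_set (Icc_subset_Icc_left ha)

theorem IsInput.zero {m : ℕ} : IsInput (fun _ : ℝ => (0 : EuclideanSpace ℝ (Fin m))) :=
  fun _ => MemLp.zero'

theorem IsControlledTrajectory.continuousOn {m : ℕ}
    {F : EuclideanSpace ℝ (Fin n) → ℝ → EuclideanSpace ℝ (Fin m) → EuclideanSpace ℝ (Fin n)}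
    {t₀ : ℝ} {x₀ : EuclideanSpace ℝ (Fin n)} {u : ℝ → EuclideanSpace ℝ (Fin m)}
    {x : ℝ → EuclideanSpace ℝ (Fin n)} (h : IsControlledTrajectory F t₀ x₀ u x) :
    ContinuousOn x (Ici t₀) := by
  intro t ht
  have ht' : t₀ ≤ t := ht
  have hle : t₀ ≤ t + 1 := by linarith
  have h1 := intervalIntegral.continuousOn_primitive_interval' (h (t + 1) hle).1 left_mem_uIcc
  rw [uIcc_of_le hle] at h1
  have h2 : ContinuousOn x (Icc t₀ (t + 1)) :=
    (continuousOn_const.add h1).congr fun s hs => (h s hs.1).2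
  refine (h2 t ⟨ht, by linarith⟩).mono_of_mem_nhdsWithin ?_
  rw [← Ici_inter_Iic]
  exact inter_mem_nhdsWithin _ (Iic_mem_nhds (by linarith))

variable {F : EuclideanSpace ℝ (Fin n) → ℝ → EuclideanSpace ℝ (Fin n)} {K : ℝ}

/-- The substitution `x = y + ∫ v`, with `v` the input cut off before `t₀`, removes the measurable
input: `y` solves an equation with continuous right-hand side. For uniqueness the input cancels in
the difference of two trajectories, and Gronwall applies. -/
theorem isControlForwardComplete_of_lipschitz (hK : 0 < K)
    (hF : Continuous fun p : EuclideanSpace ℝ (Fin n) × ℝ => F p.1 p.2)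
    (hL : ∀ t x y, ‖F x t - F y t‖ ≤ K * ‖x - y‖) :
    IsControlForwardComplete (fun x t (u : EuclideanSpace ℝ (Fin n)) => F x t + u) := by
  intro t₀ x₀ u ht₀ hu
  constructor
  · set v : ℝ → EuclideanSpace ℝ (Fin n) := (Ici t₀).indicator u with hv
    have hvi : ∀ a b, IntervalIntegrable v volume a b := by
      intro a b
      rw [intervalIntegrable_iff, hv, integrableOn_indicator_iff measurableSet_Ici]
      have h1 := hu.intervalIntegrable ht₀ (le_max_right (max a b) t₀)
      rw [intervalIntegrable_iff_integrableOn_Icc_of_le (le_max_right _ _)] at h1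
      refine h1.mono_set fun s hs => ⟨hs.1, ?_⟩
      exact hs.2.2.trans (le_max_left _ _)
    have hvc := intervalIntegral.continuous_primitive hvi t₀
    obtain ⟨y, hyc, hy⟩ := exists_global_integral_solution
      (F := fun y t => F (y + ∫ s in t₀..t, v s) t) hK
      (hF.comp (f := fun p : EuclideanSpace ℝ (Fin n) × ℝ =>
        (p.1 + ∫ s in t₀..p.2, v s, p.2))
        ((continuous_fst.add (hvc.comp continuous_snd)).prodMk continuous_snd))
      (fun t x y => by simpa using hL t (x + ∫ s in t₀..t, v s) (y + ∫ s in t₀..t, v s)) t₀ x₀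
    refine ⟨fun t => y t + ∫ s in t₀..t, v s, fun t ht => ?_⟩
    have h1 : IntervalIntegrable (fun s => F (y s + ∫ r in t₀..s, v r) s) volume t₀ t :=
      Continuous.intervalIntegrable
        (hF.comp ((hyc.add hvc).prodMk continuous_id)) _ _
    have h2 := hu.intervalIntegrable ht₀ ht
    have h3 : ∫ s in t₀..t, v s = ∫ s in t₀..t, u s := by
      refine intervalIntegral.integral_congr fun s hs => ?_
      rw [uIcc_of_le ht] at hs
      exact indicator_of_mem (mem_Ici.2 hs.1) u
    refine ⟨h1.add h2, ?_⟩
    simp only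
    rw [intervalIntegral.integral_add h1 h2, ← add_assoc, ← hy t ht, h3]
  · intro x y hx hy T hT
    have hT' : t₀ ≤ T := hT
    have hcx := hx.continuousOn
    have hcy := hy.continuousOn
    have hg : ContinuousOn (fun s => F (x s) s - F (y s) s) (Icc t₀ T) :=
      ((hF.comp_continuousOn (hcx.prodMk continuousOn_id)).sub
        (hF.comp_continuousOn (hcy.prodMk continuousOn_id))).mono Icc_subset_Ici_self
    have h0 := eq_zero_of_integral_eq (e := fun t => x t - y t) (K := K) hg
      (fun t ht => ?_) (fun t _ => hL t _ _) T ⟨hT', le_rfl⟩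
    · exact sub_eq_zero.1 h0
    · obtain ⟨hxi, hxe⟩ := hx t ht.1
      obtain ⟨hyi, hye⟩ := hy t ht.1
      rw [hxe, hye, add_sub_add_left_eq_sub, ← intervalIntegral.integral_sub hxi hyi]
      simp

theorem isTrajectory_iff_isControlledTrajectory
    (hF : Continuous fun p : EuclideanSpace ℝ (Fin n) × ℝ => F p.1 p.2)
    {t₀ : ℝ} {x₀ : EuclideanSpace ℝ (Fin n)} {x : ℝ → EuclideanSpace ℝ (Fin n)} :
    IsTrajectory F t₀ x₀ x ↔ IsControlledTrajectory
      (fun x t (u : EuclideanSpace ℝ (Fin n)) => F x t + u) t₀ x₀ (fun _ => 0) x := by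
  constructor
  · rintro ⟨h0, hx⟩ t ht
    have hc : ContinuousOn x (Ici t₀) := fun s hs => (hx s hs).continuousWithinAt
    have hFc : ContinuousOn (fun s => F (x s) s) (Ici t₀) :=
      hF.comp_continuousOn (hc.prodMk continuousOn_id)
    have hi : IntervalIntegrable (fun s => F (x s) s) volume t₀ t := by
      refine ContinuousOn.intervalIntegrable (hFc.mono ?_)
      rw [uIcc_of_le ht]; exact Icc_subset_Ici_self
    simp only [add_zero]
    refine ⟨hi, ?_⟩
    rw [intervalIntegral.integral_eq_sub_of_hasDeriv_right_of_le ht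
      (hc.mono Icc_subset_Ici_self) (fun s hs => (hx s hs.1.le).mono
        (Ioi_subset_Ici_self.trans (Ici_subset_Ici.2 hs.1.le))) hi, h0]
    abel
  · intro h
    have hc := h.continuousOn
    set y : ℝ → EuclideanSpace ℝ (Fin n) := fun t => x (max t t₀) with hy
    have hyc : Continuous y := hc.comp_continuous (by fun_prop) fun t => mem_Ici.2 (le_max_right t t₀)
    have hyx : ∀ t, t₀ ≤ t → y t = x t := fun t ht => by simp only [hy, max_eq_left ht]
    have hFc : Continuous fun s => F (y s) s := hF.comp (hyc.prodMk continuous_id)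
    have he : ∀ t, t₀ ≤ t → x t = x₀ + ∫ s in t₀..t, F (y s) s := fun t ht => by
      rw [(h t ht).2]
      congr 1
      refine intervalIntegral.integral_congr fun s hs => ?_
      rw [uIcc_of_le ht] at hs
      simp only [add_zero, hyx s hs.1]
    refine ⟨by simpa using he t₀ le_rfl, fun t ht => ?_⟩
    have hd := (intervalIntegral.integral_hasDerivAt_right (hFc.intervalIntegrable t₀ t)
      (hFc.stronglyMeasurableAtFilter _ _) hFc.continuousAt).const_add x₀
    rw [hyx t ht] at hd
    exact hd.hasDerivWithinAt.congr (fun s hs => he s hs) (he t ht)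

theorem isForwardComplete_of_lipschitz (hK : 0 < K)
    (hF : Continuous fun p : EuclideanSpace ℝ (Fin n) × ℝ => F p.1 p.2)
    (hL : ∀ t x y, ‖F x t - F y t‖ ≤ K * ‖x - y‖) : IsForwardComplete F := by
  intro t₀ x₀ ht₀
  have h := isControlForwardComplete_of_lipschitz hK hF hL t₀ x₀ (fun _ => 0) ht₀ IsInput.zero
  simp only [← isTrajectory_iff_isControlledTrajectory hF] at h
  exact h

theorem continuous_uncurry_of_lipschitz (ht : ∀ x, Continuous fun t => F x t)
    (hL : ∀ t x y, ‖F x t - F y t‖ ≤ K * ‖x - y‖) :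
    Continuous fun p : EuclideanSpace ℝ (Fin n) × ℝ => F p.1 p.2 := by
  rw [continuous_iff_continuousAt]
  rintro ⟨x, t⟩
  rw [ContinuousAt, tendsto_iff_norm_sub_tendsto_zero]
  have h1 : Tendsto (fun p : EuclideanSpace ℝ (Fin n) × ℝ => K * ‖p.1 - x‖ + ‖F x p.2 - F x t‖)
      (𝓝 (x, t)) (𝓝 0) := by
    have hx := ht x
    have : Continuous fun p : EuclideanSpace ℝ (Fin n) × ℝ =>
        K * ‖p.1 - x‖ + ‖F x p.2 - F x t‖ := by fun_prop
    simpa using this.tendsto (x, t)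
  refine squeeze_zero (fun _ => norm_nonneg _) (fun p => ?_) h1
  calc ‖F p.1 p.2 - F x t‖ ≤ ‖F p.1 p.2 - F x p.2‖ + ‖F x p.2 - F x t‖ :=
        norm_sub_le_norm_sub_add_norm_sub _ _ _
    _ ≤ _ := by gcongr; exact hL _ _ _

theorem norm_sub_le_of_norm_fderiv_le (hd : ∀ t, ContDiff ℝ 1 fun x => F x t)
    (hK : ∀ x t, ‖fderiv ℝ (fun y => F y t) x‖ ≤ K) (t : ℝ) (x y : EuclideanSpace ℝ (Fin n)) :
    ‖F x t - F y t‖ ≤ K * ‖x - y‖ :=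
  convex_univ.norm_image_sub_le_of_norm_fderiv_le
    (fun _ _ => ((hd t).differentiable one_ne_zero).differentiableAt) (fun _ _ => hK _ t)
    (mem_univ y) (mem_univ x)

end Systems

/-! ### Differential inequalities that hold almost everywhere -/

open scoped NNReal

/-- Absolute continuity supplies differentiability almost everywhere and lets the derivative be
integrated, so the bound is needed only where a derivative exists. -/
theorem sub_le_mul_of_ae_hasDerivAt_le {p : ℝ → ℝ} {a b c : ℝ} (hab : a ≤ b)
    (hp : AbsolutelyContinuousOnInterval p a b)
    (hd : ∀ᵐ t, t ∈ Ioo a b → ∀ d, HasDerivAt p d t → d ≤ c) : p b - p a ≤ c * (b - a) := by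
  rw [← hp.integral_deriv_eq_sub]
  have hc : ∫ _ in a..b, c = c * (b - a) := by
    rw [intervalIntegral.integral_const, smul_eq_mul, mul_comm]
  rw [← hc]
  refine intervalIntegral.integral_mono_ae_restrict hab hp.intervalIntegrable_deriv
    intervalIntegrable_const ?_
  rw [EventuallyLE, ae_restrict_iff' measurableSet_Icc]
  have h₁ : ∀ᵐ x : ℝ, x ≠ a := by simp [ae_iff, measure_singleton]
  have h₂ : ∀ᵐ x : ℝ, x ≠ b := by simp [ae_iff, measure_singleton]
  filter_upwards [hd, hp.ae_differentiableAt, h₁, h₂] with t ht hdiff hta htb hmem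
  refine ht ⟨lt_of_le_of_ne hmem.1 hta.symm, lt_of_le_of_ne hmem.2 htb⟩ _
    (hdiff ?_).hasDerivAt
  rwa [uIcc_of_le hab]

/-- While positive, `p` decreases. It cannot vanish before `b`: after its last nonpositive value it
would decrease to `p b > 0`. So `p ≥ p b` throughout and the slope is at most `-σ (p b)`. -/
theorem add_mul_le_of_ae_hasDerivAt_le_neg {σ p : ℝ → ℝ} {a b : ℝ} (hσ : IsClassK σ)
    (hab : a ≤ b) (hp : AbsolutelyContinuousOnInterval p a b)
    (hd : ∀ᵐ t, t ∈ Ioo a b → 0 < p t → ∀ d, HasDerivAt p d t → d ≤ -σ (p t))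
    (hb : 0 < p b) : p b + (b - a) * σ (p b) ≤ p a := by
  have hpc : ContinuousOn p (Icc a b) := by
    have := hp.continuousOn; rwa [uIcc_of_le hab] at this
  have hsub : ∀ {s t}, a ≤ s → s ≤ t → t ≤ b → AbsolutelyContinuousOnInterval p s t :=
    fun {s t} hs hst ht => hp.mono (by
      rw [uIcc_of_le hst, uIcc_of_le hab]; exact Icc_subset_Icc hs ht)
  have hdec : ∀ s, a ≤ s → s ≤ b → (∀ t ∈ Ioo s b, 0 < p t) → p b ≤ p s := by
    intro s hs hsb hpos
    have := sub_le_mul_of_ae_hasDerivAt_le (c := 0) hsb (hsub hs hsb le_rfl) (by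
      filter_upwards [hd] with t ht hts d hdt
      have h1 := ht ⟨hs.trans_lt hts.1, hts.2⟩ (hpos t hts) d hdt
      have h2 := hσ.pos (hpos t hts)
      linarith)
    linarith
  have hpos : ∀ t ∈ Icc a b, 0 < p t := by
    by_contra! hcon
    obtain ⟨t, ht, hpt⟩ := hcon
    have hcl : IsCompact (Icc a b ∩ p ⁻¹' Iic 0) :=
      isCompact_Icc.of_isClosed_subset (hpc.preimage_isClosed_of_isClosed isClosed_Icc isClosed_Iic)
        inter_subset_left
    obtain ⟨m, ⟨hm1, hm2⟩, hmax⟩ := hcl.exists_isGreatest ⟨t, ht, hpt⟩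
    have hm2' : p m ≤ 0 := hm2
    have := hdec m hm1.1 hm1.2 fun s hs => by
      by_contra! hs0
      exact absurd (hmax ⟨⟨hm1.1.trans hs.1.le, hs.2.le⟩, hs0⟩) hs.1.not_ge
    linarith
  have h := sub_le_mul_of_ae_hasDerivAt_le (c := -σ (p b)) hab hp (by
    filter_upwards [hd] with t ht hts d hdt
    have htI := Ioo_subset_Icc_self hts
    have h1 := ht hts (hpos t htI) d hdt
    have h2 := hdec t hts.1.le hts.2.le fun s hs => hpos s ⟨hts.1.le.trans hs.1.le, hs.2.le⟩
    have h3 := hσ.monotoneOn (mem_Ici.2 hb.le) (mem_Ici.2 (hpos t htI).le) h2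
    linarith)
  linarith

/-- Substitute for the chain rule when the increments of `g` are controlled by those of `e` through
a map that is merely Lipschitz. -/
theorem norm_deriv_le_of_norm_sub_le {E E' : Type*} [NormedAddCommGroup E] [NormedSpace ℝ E]
    [NormedAddCommGroup E'] [NormedSpace ℝ E'] {g : ℝ → E'} {e : ℝ → E} {g' : E'} {e' : E}
    {t C : ℝ} (hg : HasDerivAt g g' t) (he : HasDerivAt e e' t)
    (h : ∀ᶠ s in 𝓝 t, ‖g s - g t‖ ≤ C * ‖e s - e t‖) : ‖g'‖ ≤ C * ‖e'‖ := by
  have h1 := (hasDerivAt_iff_tendsto_slope.1 hg).norm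
  have h2 := ((hasDerivAt_iff_tendsto_slope.1 he).norm).const_mul C
  refine le_of_tendsto_of_tendsto h1 h2 ?_
  filter_upwards [h.filter_mono nhdsWithin_le_nhds] with s hs
  simp only [slope, vsub_eq_sub, norm_smul]
  have := mul_le_mul_of_nonneg_left hs (norm_nonneg (s - t)⁻¹)
  linarith

section LipschitzCurves

variable {E : Type*} [NormedAddCommGroup E] [NormedSpace ℝ E]

theorem ae_differentiableAt_of_lipschitzOnWith_Icc [FiniteDimensional ℝ E] {z : ℝ → E} {t₀ : ℝ}
    (hz : ∀ T, ∃ L : ℝ≥0, LipschitzOnWith L z (Icc t₀ T)) :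
    ∀ᵐ t, t₀ < t → DifferentiableAt ℝ z t := by
  have h : ∀ N : ℕ, ∀ᵐ t, t ∈ Icc t₀ N → DifferentiableWithinAt ℝ z (Icc t₀ N) t := fun N => by
    obtain ⟨L, hL⟩ := hz N
    exact hL.ae_differentiableWithinAt_of_mem
  filter_upwards [ae_all_iff.2 h] with t ht h0
  obtain ⟨N, hN⟩ := exists_nat_gt t
  exact (ht N ⟨h0.le, hN.le⟩).differentiableAt (Icc_mem_nhds h0 hN)

/-- Gronwall's inequality, obtained by integrating `exp(-κ(t-a)) ‖e t‖`, whose derivative is at most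
`B` almost everywhere. -/
theorem norm_le_mul_exp_of_ae_norm_deriv_le {e : ℝ → E} {a b κ B : ℝ} (hab : a ≤ b) (hκ : 0 ≤ κ)
    (hB : 0 ≤ B) {L : ℝ≥0} (he : LipschitzOnWith L e (Icc a b)) (h0 : e a = 0)
    (hd : ∀ᵐ t, t ∈ Ioo a b → ∃ d, HasDerivAt e d t ∧ ‖d‖ ≤ κ * ‖e t‖ + B) :
    ‖e b‖ ≤ B * (b - a) * Real.exp (κ * (b - a)) := by
  have hφ : AbsolutelyContinuousOnInterval (fun t => ‖e t‖) a b := by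
    refine LipschitzOnWith.absolutelyContinuousOnInterval (K := 1 * L) ?_
    rw [uIcc_of_le hab]
    exact lipschitzWith_one_norm.comp_lipschitzOnWith he
  have hexpd : ∀ t, HasDerivAt (fun t => Real.exp (-κ * (t - a)))
      (Real.exp (-κ * (t - a)) * -κ) t := fun t => by
    simpa using ((((hasDerivAt_id t).sub_const a).const_mul (-κ)).exp)
  have hexp : AbsolutelyContinuousOnInterval (fun t => Real.exp (-κ * (t - a))) a b := by
    refine ContDiffOn.absolutelyContinuousOnInterval (ContDiff.contDiffOn ?_)
    fun_prop
  have h := sub_le_mul_of_ae_hasDerivAt_le (c := B) hab (hexp.mul hφ) (by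
    filter_upwards [hd, hφ.ae_differentiableAt] with t ht hφt hts q hq
    obtain ⟨d, hed, hdb⟩ := ht hts
    have hφ' := (hφt (by rw [uIcc_of_le hab]; exact Ioo_subset_Icc_self hts)).hasDerivAt
    have h1 := norm_deriv_le_of_norm_sub_le (C := 1) hφ' hed (Eventually.of_forall fun s => by
      simpa using abs_norm_sub_norm_le (e s) (e t))
    have h2 := ((hexpd t).mul hφ').unique hq
    have h3 : deriv (fun t => ‖e t‖) t ≤ κ * ‖e t‖ + B := by
      have := le_abs_self (deriv (fun t => ‖e t‖) t)
      rw [← Real.norm_eq_abs] at this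
      linarith
    have h4 : Real.exp (-κ * (t - a)) ≤ 1 := Real.exp_le_one_iff.2
      (by nlinarith [hts.1])
    have h5 := (Real.exp_pos (-κ * (t - a))).le
    rw [← h2]
    nlinarith [mul_le_mul_of_nonneg_left h3 h5])
  simp only [Pi.mul_apply, h0, norm_zero, mul_zero, sub_zero] at h
  have h6 : Real.exp (κ * (b - a)) * Real.exp (-κ * (b - a)) = 1 := by
    rw [← Real.exp_add]; simp
  calc ‖e b‖ = (Real.exp (-κ * (b - a)) * ‖e b‖) * Real.exp (κ * (b - a)) := by
        rw [mul_right_comm, mul_comm (Real.exp (-κ * (b - a))), h6, one_mul]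
    _ ≤ _ := mul_le_mul_of_nonneg_right h (Real.exp_pos _).le

end LipschitzCurves

/-! ### Approximate trajectories and Lyapunov functions along them -/

section ApproxTrajectory

variable {n : ℕ}

/-- `z` is locally Lipschitz on `[t₀,∞)` and solves `ż = G(z,t)` there up to the error `m`. -/
def IsApproxTrajectory (G : EuclideanSpace ℝ (Fin n) → ℝ → EuclideanSpace ℝ (Fin n)) (t₀ : ℝ)
    (z : ℝ → EuclideanSpace ℝ (Fin n)) (m : ℝ → ℝ) : Prop :=
  (∀ T, ∃ L : ℝ≥0, LipschitzOnWith L z (Icc t₀ T)) ∧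
  ∀ᵐ t, t₀ < t → ∃ d, HasDerivAt z d t ∧ ‖d - G (z t) t‖ ≤ m t

theorem IsInput.ae_norm_le_essNorm {m : ℕ} {u : ℝ → EuclideanSpace ℝ (Fin m)} (hu : IsInput u)
    {a b : ℝ} (ha : 0 ≤ a) : ∀ᵐ t, t ∈ Icc a b → ‖u t‖ ≤ essNorm u a b := by
  have hmem : MemLp u ⊤ (volume.restrict (Icc a b)) :=
    (hu b).mono_measure (Measure.restrict_mono (Icc_subset_Icc_left ha) le_rfl)
  rw [← ae_restrict_iff' measurableSet_Icc]
  filter_upwards [ae_le_eLpNormEssSup (f := u) (μ := volume.restrict (Icc a b))] with t ht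
  rw [← eLpNorm_exponent_top] at ht
  rw [essNorm, ← toReal_enorm]
  exact ENNReal.toReal_mono hmem.eLpNorm_ne_top ht

variable {F : EuclideanSpace ℝ (Fin n) → ℝ → EuclideanSpace ℝ (Fin n)}
  {t₀ : ℝ} {x₀ : EuclideanSpace ℝ (Fin n)} {u x : ℝ → EuclideanSpace ℝ (Fin n)}

theorem IsControlledTrajectory.exists_lipschitzOnWith
    (hF : Continuous fun p : EuclideanSpace ℝ (Fin n) × ℝ => F p.1 p.2) (ht₀ : 0 ≤ t₀)
    (hu : IsInput u) (hx : IsControlledTrajectory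
      (fun x t (u : EuclideanSpace ℝ (Fin n)) => F x t + u) t₀ x₀ u x) (T : ℝ) :
    ∃ L : ℝ≥0, LipschitzOnWith L x (Icc t₀ T) := by
  have hc := hx.continuousOn
  have hFc : ContinuousOn (fun s => F (x s) s) (Icc t₀ T) :=
    (hF.comp_continuousOn (hc.prodMk continuousOn_id)).mono Icc_subset_Ici_self
  obtain ⟨M, hM⟩ := isCompact_Icc.exists_bound_of_continuousOn hFc
  refine ⟨(M + essNorm u t₀ T).toNNReal, LipschitzOnWith.of_dist_le_mul ?_⟩
  have key : ∀ a ∈ Icc t₀ T, ∀ b ∈ Icc t₀ T, a ≤ b →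
      ‖x b - x a‖ ≤ (M + essNorm u t₀ T).toNNReal * |b - a| := by
    intro a ha b hb hab
    rw [(hx a ha.1).2, (hx b hb.1).2, add_sub_add_left_eq_sub,
      intervalIntegral.integral_interval_sub_left (hx b hb.1).1 (hx a ha.1).1]
    refine intervalIntegral.norm_integral_le_of_norm_le_const_ae ?_
    filter_upwards [hu.ae_norm_le_essNorm (b := T) ht₀] with s hs hsI
    rw [uIoc_of_le hab] at hsI
    have hsI' : s ∈ Icc t₀ T := ⟨ha.1.trans hsI.1.le, hsI.2.trans hb.2⟩
    refine (norm_add_le _ _).trans ((add_le_add (hM s hsI') (hs hsI')).trans ?_)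
    exact Real.le_coe_toNNReal _
  intro a ha b hb
  rcases le_total a b with hab | hab
  · rw [dist_comm, dist_comm a, dist_eq_norm, Real.dist_eq]
    exact key a ha b hb hab
  · rw [dist_eq_norm, Real.dist_eq]
    exact key b hb a ha hab

theorem IsControlledTrajectory.ae_hasDerivAt (hx : IsControlledTrajectory
      (fun x t (u : EuclideanSpace ℝ (Fin n)) => F x t + u) t₀ x₀ u x) :
    ∀ᵐ t, t₀ < t → HasDerivAt x (F (x t) t + u t) t := by
  have h : ∀ N : ℕ, ∀ᵐ t, t ∈ Ioo t₀ (N : ℝ) → HasDerivAt x (F (x t) t + u t) t := by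
    intro N
    rcases le_or_gt (N : ℝ) t₀ with hN | hN
    · exact Eventually.of_forall fun t ht => absurd (ht.1.trans ht.2) hN.not_gt
    filter_upwards [(hx N hN.le).1.ae_hasDerivAt_integral] with t ht htI
    rw [uIcc_of_le hN.le] at ht
    have h1 := (ht (Ioo_subset_Icc_self htI) t₀ ⟨le_rfl, hN.le⟩).const_add x₀
    refine h1.congr_of_eventuallyEq ?_
    filter_upwards [Ioi_mem_nhds htI.1] with s hs
    exact (hx s (le_of_lt hs)).2
  filter_upwards [ae_all_iff.2 h] with t ht h0
  obtain ⟨N, hN⟩ := exists_nat_gt t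
  exact ht N ⟨h0, hN⟩

theorem exists_lipschitzOnWith_comp {V : EuclideanSpace ℝ (Fin n) → ℝ → ℝ}
    (hV : ContDiffOn ℝ 1 (fun p : EuclideanSpace ℝ (Fin n) × ℝ => V p.1 p.2) (univ ×ˢ Ici 0))
    (ht₀ : 0 ≤ t₀) {T : ℝ} {L : ℝ≥0} {z : ℝ → EuclideanSpace ℝ (Fin n)}
    (hz : LipschitzOnWith L z (Icc t₀ T)) :
    ∃ L' : ℝ≥0, LipschitzOnWith L' (fun t => V (z t) t) (Icc t₀ T) := by
  obtain ⟨M, hM⟩ := isCompact_Icc.exists_bound_of_continuousOn hz.continuousOn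
  obtain ⟨K, hK⟩ := (hV.mono (s := univ ×ˢ Ici 0)
    (t := Metric.closedBall 0 M ×ˢ Icc 0 T)
    (prod_mono (subset_univ _) Icc_subset_Ici_self)).exists_lipschitzOnWith one_ne_zero
    ((convex_closedBall _ _).prod (convex_Icc _ _))
    ((isCompact_closedBall _ _).prod isCompact_Icc)
  refine ⟨_, hK.comp (hz.prodMk (LipschitzWith.id.lipschitzOnWith)) ?_⟩
  exact fun t ht => ⟨by simpa using hM t ht, ht₀.trans ht.1, ht.2⟩

/-- The derivative of `V` along a curve. -/
theorem hasDerivAt_comp_curve {V : EuclideanSpace ℝ (Fin n) → ℝ → ℝ}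
    (hV : ContDiffOn ℝ 1 (fun p : EuclideanSpace ℝ (Fin n) × ℝ => V p.1 p.2) (univ ×ˢ Ici 0))
    {t : ℝ} (ht : 0 < t) {z : ℝ → EuclideanSpace ℝ (Fin n)} {d : EuclideanSpace ℝ (Fin n)}
    (hz : HasDerivAt z d t) :
    HasDerivAt (fun s => V (z s) s) (timeDeriv V (z t) t + spaceDeriv V (z t) t d) t := by
  have hnhds : (univ ×ˢ Ici 0 : Set (EuclideanSpace ℝ (Fin n) × ℝ)) ∈ 𝓝 (z t, t) :=
    prod_mem_nhds univ_mem (Ici_mem_nhds ht)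
  have hdiff : DifferentiableAt ℝ (fun p : EuclideanSpace ℝ (Fin n) × ℝ => V p.1 p.2) (z t, t) :=
    (hV.contDiffAt hnhds).differentiableAt one_ne_zero
  set A := fderiv ℝ (fun p : EuclideanSpace ℝ (Fin n) × ℝ => V p.1 p.2) (z t, t) with hA
  have hfd : HasFDerivAt (fun p : EuclideanSpace ℝ (Fin n) × ℝ => V p.1 p.2) A (z t, t) :=
    hdiff.hasFDerivAt
  have h1 : HasDerivAt (fun s => V (z s) s) (A (d, 1)) t :=
    hfd.comp_hasDerivAt (f := fun s => (z s, s)) t (hz.prodMk (hasDerivAt_id t))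
  have h2 : timeDeriv V (z t) t = A (0, 1) := by
    have : HasDerivAt (fun s => V (z t) s) (A (0, 1)) t :=
      hfd.comp_hasDerivAt (f := fun s => (z t, s)) t ((hasDerivAt_const t (z t)).prodMk
        (hasDerivAt_id t))
    exact this.hasDerivWithinAt.derivWithin (uniqueDiffOn_Ici 0 t ht.le)
  have h3 : spaceDeriv V (z t) t d = A (d, 0) := by
    have : HasFDerivAt (fun y => V y t)
        (A.comp (ContinuousLinearMap.inl ℝ (EuclideanSpace ℝ (Fin n)) ℝ)) (z t) :=
      hfd.comp (f := fun y => (y, t)) (z t) (hasFDerivAt_prodMk_left (z t) t)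
    rw [spaceDeriv, this.fderiv]
    simp
  have h4 : A (d, 1) = A (0, 1) + A (d, 0) := by rw [← map_add]; simp
  rw [h2, h3, ← h4]
  exact h1

end ApproxTrajectory

/-! ### The averaging transformation -/

section Averaging

variable {E : Type*} [NormedAddCommGroup E] [NormedSpace ℝ E] {h : ℝ}

/-- The time-dependent shift that replaces `p` by its average over a window of length `h`. -/
noncomputable def averagingShift (p : E → ℝ → E) (h : ℝ) (x : E) (t : ℝ) : E :=
  -(h⁻¹ • ∫ l in (t - h)..t, (l - (t - h)) • p x l)

theorem norm_integral_weight_le {q : ℝ → E} {B t : ℝ} (hh : 0 < h) (hq : ∀ l, ‖q l‖ ≤ B) :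
    ‖∫ l in (t - h)..t, (l - (t - h)) • q l‖ ≤ h * B * h := by
  have h1 := intervalIntegral.norm_integral_le_of_norm_le_const (a := t - h) (b := t) (C := h * B)
    (f := fun l => (l - (t - h)) • q l) (fun l hl => by
      rw [uIoc_of_le (by linarith)] at hl
      rw [norm_smul, Real.norm_of_nonneg (by linarith [hl.1])]
      exact mul_le_mul (by linarith [hl.2]) (hq l) (norm_nonneg _) hh.le)
  rwa [sub_sub_cancel, abs_of_pos hh] at h1

theorem norm_averagingShift_le {p : E → ℝ → E} {x : E} {B t : ℝ} (hh : 0 < h)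
    (hp : ∀ l, ‖p x l‖ ≤ B) : ‖averagingShift p h x t‖ ≤ h * B := by
  rw [averagingShift, norm_neg, norm_smul, norm_inv, Real.norm_of_nonneg hh.le,
    inv_mul_le_iff₀ hh]
  linarith [norm_integral_weight_le (t := t) hh hp]

theorem norm_averagingShift_sub_le {p : E → ℝ → E} {x y : E} {L t : ℝ} (hh : 0 < h)
    (hpx : Continuous (p x)) (hpy : Continuous (p y)) (hp : ∀ l, ‖p x l - p y l‖ ≤ L * ‖x - y‖) :
    ‖averagingShift p h x t - averagingShift p h y t‖ ≤ h * L * ‖x - y‖ := by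
  have h1 : averagingShift p h x t - averagingShift p h y t =
      averagingShift (fun _ l => p x l - p y l) h x t := by
    simp only [averagingShift, smul_sub]
    rw [intervalIntegral.integral_sub (Continuous.intervalIntegrable (by fun_prop) _ _)
      (Continuous.intervalIntegrable (by fun_prop) _ _), smul_sub]
    abel
  rw [h1, mul_assoc]
  exact norm_averagingShift_le hh hp

theorem hasDerivAt_integral_window [CompleteSpace E] {q : ℝ → E} (hq : Continuous q) (t : ℝ) :
    HasDerivAt (fun t => ∫ l in (t - h)..t, q l) (q t - q (t - h)) t := by
  have hd : ∀ t, HasDerivAt (fun t => ∫ l in (0 : ℝ)..t, q l) (q t) t := fun t =>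
    intervalIntegral.integral_hasDerivAt_right (hq.intervalIntegrable _ _)
      (hq.stronglyMeasurableAtFilter _ _) hq.continuousAt
  have h1 : (fun t => ∫ l in (t - h)..t, q l) =
      fun t => (∫ l in (0 : ℝ)..t, q l) - ∫ l in (0 : ℝ)..(t - h), q l := by
    funext t
    rw [intervalIntegral.integral_interval_sub_left (hq.intervalIntegrable _ _)
      (hq.intervalIntegrable _ _)]
  rw [h1]
  have h2 := (hd (t - h)).scomp t ((hasDerivAt_id t).sub_const h)
  rw [one_smul] at h2
  exact (hd t).sub h2

/-- The weight `l - (t-h)` vanishes at the left end of the window and equals `h` at the right end,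
so the moving endpoints contribute exactly `-p x t`; the weight's own derivative `-1` produces the
mean. -/
theorem hasDerivAt_averagingShift [CompleteSpace E] {p : E → ℝ → E} {x : E} (hh : 0 < h)
    (hp : Continuous (p x)) (t : ℝ) :
    HasDerivAt (averagingShift p h x) (-p x t + h⁻¹ • ∫ l in (t - h)..t, p x l) t := by
  have h1 : averagingShift p h x = fun t =>
      -(h⁻¹ • ((∫ l in (t - h)..t, l • p x l) - (t - h) • ∫ l in (t - h)..t, p x l)) := by
    funext t
    simp only [averagingShift, sub_smul (_ : ℝ) (t - h)]
    rw [intervalIntegral.integral_sub (Continuous.intervalIntegrable (by fun_prop) _ _)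
      (Continuous.intervalIntegrable (by fun_prop) _ _), intervalIntegral.integral_smul]
  rw [h1]
  have hA := hasDerivAt_integral_window (h := h) (q := fun l => l • p x l) (by fun_prop) t
  have hB := ((hasDerivAt_id t).sub_const h).smul (hasDerivAt_integral_window (h := h) hp t)
  refine (((hA.sub hB).const_smul h⁻¹).neg).congr_deriv ?_
  simp only [id, one_smul]
  have h2 : t • p x t - (t - h) • p x (t - h) -
      ((t - h) • (p x t - p x (t - h)) + ∫ l in (t - h)..t, p x l) =
      h • p x t - ∫ l in (t - h)..t, p x l := by
    module
  rw [h2, smul_sub, smul_smul, inv_mul_cancel₀ hh.ne', one_smul]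
  abel

end Averaging

/-! ### The averaged variable solves the limit system approximately -/

section Transformation

variable {n : ℕ} {g fbar : EuclideanSpace ℝ (Fin n) → ℝ → EuclideanSpace ℝ (Fin n)}
  {δ : ℝ → ℝ} {K h c ε t₀ : ℝ} {x₀ : EuclideanSpace ℝ (Fin n)}
  {u x : ℝ → EuclideanSpace ℝ (Fin n)}

theorem norm_averagingShift_le_half (hh : 0 < h) (hlin : ∀ s, 0 ≤ s → δ s ≤ c * s)
    (hg : ∀ x t, ‖g x t‖ ≤ δ (‖x‖ / 2)) (hfbar : ∀ x t, ‖fbar x t‖ ≤ δ (‖x‖ / 2))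
    (hhc : h * c ≤ 1 / 2) (ξ : EuclideanSpace ℝ (Fin n)) (t : ℝ) :
    ‖averagingShift (fun x t => g x t - fbar x t) h ξ t‖ ≤ ‖ξ‖ / 2 := by
  refine (norm_averagingShift_le (B := 2 * (c * (‖ξ‖ / 2))) hh fun l => ?_).trans ?_
  · have := hlin (‖ξ‖ / 2) (by positivity)
    refine (norm_sub_le _ _).trans ?_
    linarith [hg ξ l, hfbar ξ l]
  · nlinarith [norm_nonneg ξ]

/-- In `ż` the term `p(x,t)` cancels against the shift. What remains is the mean of `p` (at most `ε
δ`), the variation of the shift with `x` (at most `2Kh(δ + |u|)`), the replacement of `x` by `z` in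
`fbar` (at most `2Kh δ`), and `u` itself, with `δ` taken at `|x|/2`. -/
theorem isApproxTrajectory_averagingShift (hδ : IsClassK δ)
    (hlin : ∀ s, 0 ≤ s → δ s ≤ c * s)
    (hgt : ∀ x, Continuous fun t => g x t) (hft : ∀ x, Continuous fun t => fbar x t)
    (hgL : ∀ t x y, ‖g x t - g y t‖ ≤ K * ‖x - y‖)
    (hfL : ∀ t x y, ‖fbar x t - fbar y t‖ ≤ K * ‖x - y‖)
    (hg : ∀ x t, ‖g x t‖ ≤ δ (‖x‖ / 2)) (hfbar : ∀ x t, ‖fbar x t‖ ≤ δ (‖x‖ / 2))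
    (hK : 0 < K) (hh : 0 < h) (hhK : 2 * K * h ≤ 1) (hhc : h * c ≤ 1 / 2)
    (havg : ∀ x t, ‖h⁻¹ • ∫ l in (t - h)..t, (g x l - fbar x l)‖ ≤ ε * δ (‖x‖ / 2))
    (hε : 0 ≤ ε) (ht₀ : 0 ≤ t₀) (hu : IsInput u)
    (hx : IsControlledTrajectory (fun x t (u : EuclideanSpace ℝ (Fin n)) => g x t + u) t₀ x₀ u x) :
    IsApproxTrajectory fbar t₀
      (fun t => x t + averagingShift (fun x t => g x t - fbar x t) h (x t) t)
      (fun t => (ε + 4 * K * h) *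
        δ ‖x t + averagingShift (fun x t => g x t - fbar x t) h (x t) t‖ + 2 * ‖u t‖) := by
  set p : EuclideanSpace ℝ (Fin n) → ℝ → EuclideanSpace ℝ (Fin n) :=
    fun x t => g x t - fbar x t with hp
  have hpc : ∀ x, Continuous (p x) := fun x => (hgt x).sub (hft x)
  have hpL : ∀ x y l, ‖p x l - p y l‖ ≤ 2 * K * ‖x - y‖ := fun x y l => by
    have : p x l - p y l = (g x l - g y l) - (fbar x l - fbar y l) := by simp only [hp]; abel
    rw [this]
    refine (norm_sub_le _ _).trans ?_
    linarith [hgL l x y, hfL l x y]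
  have hpb : ∀ x l, ‖p x l‖ ≤ 2 * δ (‖x‖ / 2) := fun x l => by
    refine (norm_sub_le _ _).trans ?_
    linarith [hg x l, hfbar x l]
  have hRL : ∀ t x y, ‖averagingShift p h x t - averagingShift p h y t‖ ≤
      2 * K * h * ‖x - y‖ := fun t x y => by
    have := norm_averagingShift_sub_le (t := t) hh (hpc x) (hpc y) (hpL x y)
    linarith
  have hgc := continuous_uncurry_of_lipschitz hgt hgL
  have hxc := hx.continuousOn
  have hLip : ∀ T, ∃ L : ℝ≥0,
      LipschitzOnWith L (fun t => x t + averagingShift p h (x t) t) (Icc t₀ T) := by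
    intro T
    obtain ⟨L, hL⟩ := hx.exists_lipschitzOnWith hgc ht₀ hu T
    obtain ⟨M, hM⟩ := isCompact_Icc.exists_bound_of_continuousOn
      (hxc.mono (Icc_subset_Ici_self : Icc t₀ T ⊆ Ici t₀))
    refine ⟨(L + (L + 4 * δ (M / 2))).toNNReal, LipschitzOnWith.of_dist_le_mul ?_⟩
    intro a ha b hb
    have hM0 : 0 ≤ M := (norm_nonneg _).trans (hM b hb)
    have h1 : ‖x a - x b‖ ≤ L * |a - b| := by
      simpa [dist_eq_norm] using hL.dist_le_mul a ha b hb
    have h2 : ‖averagingShift p h (x b) a - averagingShift p h (x b) b‖ ≤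
        4 * δ (M / 2) * |a - b| := by
      refine Convex.norm_image_sub_le_of_norm_hasDerivWithin_le (s := univ)
        (fun t _ => (hasDerivAt_averagingShift hh (hpc (x b)) t).hasDerivWithinAt)
        (fun t _ => ?_) convex_univ (mem_univ _) (mem_univ _)
      have hδM : δ (‖x b‖ / 2) ≤ δ (M / 2) := hδ.monotoneOn (mem_Ici.2 (by positivity))
        (mem_Ici.2 (by positivity)) (by linarith [hM b hb])
      have h3 : ‖h⁻¹ • ∫ l in (t - h)..t, p (x b) l‖ ≤ 2 * δ (‖x b‖ / 2) := by
        rw [norm_smul, norm_inv, Real.norm_of_nonneg hh.le, inv_mul_le_iff₀ hh]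
        have := intervalIntegral.norm_integral_le_of_norm_le_const (a := t - h) (b := t)
          (f := p (x b)) (C := 2 * δ (‖x b‖ / 2)) (fun l _ => hpb (x b) l)
        rw [sub_sub_cancel, abs_of_pos hh] at this
        linarith
      refine (norm_add_le _ _).trans ?_
      rw [norm_neg]
      linarith [hpb (x b) t]
    have h3 := hRL a (x a) (x b)
    have h4 : 2 * K * h * ‖x a - x b‖ ≤ ‖x a - x b‖ :=
      mul_le_of_le_one_left (norm_nonneg _) hhK
    have h5 : x a + averagingShift p h (x a) a - (x b + averagingShift p h (x b) b) =
        (x a - x b) + ((averagingShift p h (x a) a - averagingShift p h (x b) a) +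
          (averagingShift p h (x b) a - averagingShift p h (x b) b)) := by abel
    rw [dist_eq_norm, Real.dist_eq, h5]
    refine (norm_add_le _ _).trans ((add_le_add le_rfl (norm_add_le _ _)).trans ?_)
    refine le_trans ?_ (mul_le_mul_of_nonneg_right (Real.le_coe_toNNReal _) (abs_nonneg _))
    linarith
  refine ⟨hLip, ?_⟩
  filter_upwards [ae_differentiableAt_of_lipschitzOnWith_Icc hLip, hx.ae_hasDerivAt] with t hzt hxt
    ht
  have hz := (hzt ht).hasDerivAt
  have hxd := hxt ht
  set z : ℝ → EuclideanSpace ℝ (Fin n) := fun t => x t + averagingShift p h (x t) t with hz_def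
  set R' := -p (x t) t + h⁻¹ • ∫ l in (t - h)..t, p (x t) l with hR'
  have hR := hasDerivAt_averagingShift hh (hpc (x t)) t
  -- The part of `ż` due to the dependence of the shift on `x`, bounded through its Lipschitz
  -- constant without differentiating the shift in `x`.
  have h1 : ‖deriv z t - (g (x t) t + u t) - R'‖ ≤ 2 * K * h * ‖g (x t) t + u t‖ := by
    refine norm_deriv_le_of_norm_sub_le ((hz.sub hxd).sub hR) hxd
      (Eventually.of_forall fun s => ?_)
    have : z s - x s - averagingShift p h (x t) s - (z t - x t - averagingShift p h (x t) t) =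
        averagingShift p h (x s) s - averagingShift p h (x t) s := by
      simp only [hz_def]; abel
    simp only [Pi.sub_apply]
    rw [this]
    exact hRL s _ _
  refine ⟨deriv z t, hz, ?_⟩
  have hsplit : deriv z t - fbar (z t) t = (deriv z t - (g (x t) t + u t) - R') +
      ((fbar (x t) t - fbar (z t) t) + (h⁻¹ • (∫ l in (t - h)..t, p (x t) l) + u t)) := by
    simp only [hR', hp]; abel
  have h2 : ‖fbar (x t) t - fbar (z t) t‖ ≤ K * (h * (2 * δ (‖x t‖ / 2))) := by
    refine (hfL t _ _).trans (mul_le_mul_of_nonneg_left ?_ hK.le)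
    have : x t - z t = -averagingShift p h (x t) t := by simp only [hz_def]; abel
    rw [this, norm_neg]
    exact norm_averagingShift_le hh (hpb (x t))
  have h3 := havg (x t) t
  have h4 : 2 * K * h * ‖g (x t) t + u t‖ ≤ 2 * K * h * δ (‖x t‖ / 2) + ‖u t‖ := by
    have h5 : 2 * K * h * ‖g (x t) t + u t‖ ≤ 2 * K * h * (δ (‖x t‖ / 2) + ‖u t‖) :=
      mul_le_mul_of_nonneg_left ((norm_add_le _ _).trans (add_le_add (hg _ _) le_rfl))
        (by positivity)
    have h6 : 2 * K * h * ‖u t‖ ≤ ‖u t‖ := mul_le_of_le_one_left (norm_nonneg _) hhK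
    linarith
  -- The shift is at most `‖x‖ / 2`, so `‖x‖ / 2 ≤ ‖z‖`: this is where the argument `‖x‖ / 2` in the
  -- growth bounds pays off.
  have h5 : δ (‖x t‖ / 2) ≤ δ ‖z t‖ := by
    refine hδ.monotoneOn (mem_Ici.2 (by positivity)) (mem_Ici.2 (norm_nonneg _)) ?_
    have h6 := norm_averagingShift_le_half hh hlin hg hfbar hhc (x t) t
    have h7 : ‖x t‖ ≤ ‖z t‖ + ‖averagingShift p h (x t) t‖ := by
      have : x t = z t - averagingShift p h (x t) t := by simp only [hz_def]; abel
      calc ‖x t‖ = ‖z t - averagingShift p h (x t) t‖ := by rw [← this]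
        _ ≤ _ := norm_sub_le _ _
    linarith
  have h6 : (ε + 4 * K * h) * δ (‖x t‖ / 2) ≤ (ε + 4 * K * h) * δ ‖z t‖ :=
    mul_le_mul_of_nonneg_left h5 (by positivity)
  rw [hsplit]
  refine (norm_add_le _ _).trans ?_
  refine (add_le_add h1 ((norm_add_le _ _).trans (add_le_add h2 (norm_add_le _ _)))).trans ?_
  have h8 : ‖h⁻¹ • ∫ l in (t - h)..t, p (x t) l‖ ≤ ε * δ (‖x t‖ / 2) := h3
  linarith

end Transformation

/-! ### Comparison estimates -/

section Comparison

variable {σ W v : ℝ → ℝ} {β : ℝ → ℝ → ℝ} {a b : ℝ}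

/-- Subtract the accumulated input. As `p = W - ∫ v ≤ W`, monotonicity of `σ` gives `ṗ ≤ -σ(p)`
wherever `p > 0`. -/
theorem le_add_integral_of_ae_hasDerivAt_le (hσ : IsClassK σ) (hβ : IsClassKL β)
    (hσβ : ∀ s t r, 0 ≤ s → 0 ≤ t → 0 ≤ r → r + t * σ r ≤ s → r ≤ β s t) (hab : a ≤ b)
    (hW : AbsolutelyContinuousOnInterval W a b) (hWa : 0 ≤ W a)
    (hv : IntervalIntegrable v volume a b) (hv0 : ∀ t, 0 ≤ v t)
    (hd : ∀ᵐ t, t ∈ Ioo a b → ∀ d, HasDerivAt W d t → d ≤ -σ (W t) + v t) :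
    W b ≤ β (W a) (b - a) + ∫ s in a..b, v s := by
  have hβ0 : 0 ≤ β (W a) (b - a) := (hβ.classKInfty _ (sub_nonneg.2 hab)).nonneg hWa
  set p : ℝ → ℝ := fun t => W t - ∫ s in a..t, v s with hp
  rcases le_or_gt (p b) 0 with hpb | hpb
  · simp only [hp] at hpb
    linarith
  have hI := hv.absolutelyContinuousOnInterval_intervalIntegral (c := a) left_mem_uIcc
  have h := add_mul_le_of_ae_hasDerivAt_le_neg hσ hab (p := p) (hW.sub hI) (by
    filter_upwards [hd, hv.ae_hasDerivAt_integral] with t ht hvt hts hpt d hdt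
    have hvt' := hvt (by rw [uIcc_of_le hab]; exact Ioo_subset_Icc_self hts) a left_mem_uIcc
    have hWd : HasDerivAt W (d + v t) t := by
      have := hdt.add hvt'
      refine this.congr_of_eventuallyEq (Eventually.of_forall fun s => ?_)
      simp [hp]
    have h1 := ht hts _ hWd
    have h2 : p t ≤ W t := by
      have : 0 ≤ ∫ s in a..t, v s :=
        intervalIntegral.integral_nonneg hts.1.le fun s _ => hv0 s
      simp only [hp]; linarith
    have h3 := hσ.monotoneOn (mem_Ici.2 hpt.le) (mem_Ici.2 (hpt.le.trans h2)) h2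
    linarith) hpb
  have hpa : p a = W a := by simp [hp]
  rw [hpa] at h
  have h1 := hσβ _ _ _ hWa (sub_nonneg.2 hab) hpb.le h
  simp only [hp] at h1
  linarith

/-- Above the level `w` with `σ w = 2B`, half of the decay absorbs `B`; the other half drives `W -
w` down. -/
theorem le_add_of_ae_hasDerivAt_le_add_const {B w : ℝ} (hσ : IsClassK σ) (hβ : IsClassKL β)
    (hσβ : ∀ s t r, 0 ≤ s → 0 ≤ t → 0 ≤ r → r + t * (1 / 2 * σ r) ≤ s → r ≤ β s t)
    (hab : a ≤ b) (hW : AbsolutelyContinuousOnInterval W a b) (hWa : 0 ≤ W a)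
    (hw : 0 ≤ w) (hwB : σ w = 2 * B)
    (hd : ∀ᵐ t, t ∈ Ioo a b → ∀ d, HasDerivAt W d t → d ≤ -σ (W t) + B) :
    W b ≤ β (W a) (b - a) + w := by
  have hβ0 : 0 ≤ β (W a) (b - a) := (hβ.classKInfty _ (sub_nonneg.2 hab)).nonneg hWa
  rcases le_or_gt (W b - w) 0 with hpb | hpb
  · linarith
  have hw' : AbsolutelyContinuousOnInterval (fun _ : ℝ => w) a b :=
    contDiff_const.contDiffOn.absolutelyContinuousOnInterval
  have hσ' : IsClassK fun s => 1 / 2 * σ s :=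
    ⟨hσ.continuousOn.const_smul (1 / 2 : ℝ), by simp [hσ.map_zero], fun _ hs _ ht hst =>
      mul_lt_mul_of_pos_left (hσ.strictMonoOn hs ht hst) (by norm_num)⟩
  have h := add_mul_le_of_ae_hasDerivAt_le_neg hσ' hab
    (p := fun t => W t - w) (hW.sub hw') (by
    filter_upwards [hd] with t ht hts hpt d hdt
    have hWd : HasDerivAt W d t := by
      simpa using hdt.add_const w
    have h1 := ht hts _ hWd
    have h2 := hσ.monotoneOn (mem_Ici.2 hw) (mem_Ici.2 (by linarith : (0 : ℝ) ≤ W t))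
      (by linarith)
    have h3 := hσ.monotoneOn (mem_Ici.2 hpt.le) (mem_Ici.2 (by linarith : (0 : ℝ) ≤ W t))
      (by linarith)
    linarith) hpb
  have h1 := hσβ (W a) (b - a) (W b - w) hWa (sub_nonneg.2 hab) hpb.le (by linarith)
  linarith

end Comparison

/-! ### Decay of the Lyapunov function along approximate trajectories -/

section Dissipation

variable {n : ℕ} {fbar : EuclideanSpace ℝ (Fin n) → ℝ → EuclideanSpace ℝ (Fin n)}
  {V : EuclideanSpace ℝ (Fin n) → ℝ → ℝ} {δ δ₂ δ₂' : ℝ → ℝ} {c ε t₀ : ℝ}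
  {u z : ℝ → EuclideanSpace ℝ (Fin n)}

theorem absolutelyContinuousOnInterval_comp_approxTrajectory {m : ℝ → ℝ}
    (hV : ContDiffOn ℝ 1 (fun p : EuclideanSpace ℝ (Fin n) × ℝ => V p.1 p.2) (univ ×ˢ Ici 0))
    (ht₀ : 0 ≤ t₀) (hz : IsApproxTrajectory fbar t₀ z m) {T : ℝ} (hT : t₀ ≤ T) :
    AbsolutelyContinuousOnInterval (fun t => V (z t) t) t₀ T := by
  obtain ⟨L, hL⟩ := hz.1 T
  obtain ⟨L', hL'⟩ := exists_lipschitzOnWith_comp hV ht₀ hL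
  rw [← uIcc_of_le hT] at hL'
  exact hL'.absolutelyContinuousOnInterval

/-- Of the decay `c δ(|z|)²`, half absorbs the `ε` term, a quarter absorbs the input term by Young's
inequality, and a quarter survives. Since `δ₂'` inverts `δ₂`, one has `δ₂' V ≤ |z|`, which turns the
surviving part into a function of `V`. -/
theorem ae_hasDerivAt_lyapunov_le (hc : 0 < c) (hδ : IsClassK δ)
    (hV : ContDiffOn ℝ 1 (fun p : EuclideanSpace ℝ (Fin n) × ℝ => V p.1 p.2) (univ ×ˢ Ici 0))
    (hδ₂ : IsClassK δ₂') (hδ₂' : ∀ s, 0 ≤ s → δ₂' (δ₂ s) = s)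
    (hV0 : ∀ ξ t, 0 ≤ t → 0 ≤ V ξ t) (hVδ₂ : ∀ ξ t, 0 ≤ t → V ξ t ≤ δ₂ ‖ξ‖)
    (hdecay : ∀ ξ t, 0 ≤ t →
      timeDeriv V ξ t + spaceDeriv V ξ t (fbar ξ t) ≤ -c * δ ‖ξ‖ ^ 2)
    (hgrad : ∀ ξ t, 0 ≤ t → ‖spaceDeriv V ξ t‖ ≤ δ ‖ξ‖) (ht₀ : 0 ≤ t₀)
    (hε : ε ≤ c / 2)
    (hz : IsApproxTrajectory fbar t₀ z (fun t => ε * δ ‖z t‖ + 2 * ‖u t‖)) :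
    ∀ᵐ t, t₀ < t → ∀ d, HasDerivAt (fun t => V (z t) t) d t →
      d ≤ -(c / 4 * δ (δ₂' (V (z t) t)) ^ 2) + 4 / c * ‖u t‖ ^ 2 := by
  filter_upwards [hz.2] with t ht htt d hd
  obtain ⟨e, he, hee⟩ := ht htt
  have ht0 : 0 < t := ht₀.trans_lt htt
  have h1 := (hasDerivAt_comp_curve hV ht0 he).unique hd
  have h2 : spaceDeriv V (z t) t e = spaceDeriv V (z t) t (fbar (z t) t) +
      spaceDeriv V (z t) t (e - fbar (z t) t) := by rw [← map_add]; congr 1; abel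
  have hδ0 : 0 ≤ δ ‖z t‖ := hδ.nonneg (norm_nonneg _)
  have h3 : spaceDeriv V (z t) t (e - fbar (z t) t) ≤
      δ ‖z t‖ * (ε * δ ‖z t‖ + 2 * ‖u t‖) := by
    refine (le_abs_self _).trans (((spaceDeriv V (z t) t).le_opNorm _).trans ?_)
    exact mul_le_mul (hgrad _ _ ht0.le) hee (norm_nonneg _) hδ0
  have h4 := hdecay (z t) t ht0.le
  have h5 : δ₂' (V (z t) t) ≤ ‖z t‖ := by
    have h6 := hV0 (z t) t ht0.le
    have h7 := hVδ₂ (z t) t ht0.le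
    have := hδ₂.monotoneOn (mem_Ici.2 h6) (mem_Ici.2 (h6.trans h7)) h7
    rwa [hδ₂' _ (norm_nonneg _)] at this
  have h6 : 0 ≤ δ₂' (V (z t) t) := hδ₂.nonneg (hV0 (z t) t ht0.le)
  have h7 : δ (δ₂' (V (z t) t)) ^ 2 ≤ δ ‖z t‖ ^ 2 :=
    pow_le_pow_left₀ (hδ.nonneg h6) (hδ.monotoneOn (mem_Ici.2 h6) (mem_Ici.2 (norm_nonneg _)) h5) 2
  have h8 : 2 * (δ ‖z t‖ * ‖u t‖) ≤ c / 4 * δ ‖z t‖ ^ 2 + 4 / c * ‖u t‖ ^ 2 := by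
    have h9 : c / 4 * δ ‖z t‖ ^ 2 + 4 / c * ‖u t‖ ^ 2 - 2 * (δ ‖z t‖ * ‖u t‖) =
        c / 4 * (δ ‖z t‖ - 4 / c * ‖u t‖) ^ 2 := by
      field_simp
      ring
    have : 0 ≤ c / 4 * (δ ‖z t‖ - 4 / c * ‖u t‖) ^ 2 := by positivity
    linarith
  have h9 : ε * δ ‖z t‖ ^ 2 ≤ c / 2 * δ ‖z t‖ ^ 2 :=
    mul_le_mul_of_nonneg_right hε (sq_nonneg _)
  have h10 : c / 4 * δ (δ₂' (V (z t) t)) ^ 2 ≤ c / 4 * δ ‖z t‖ ^ 2 :=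
    mul_le_mul_of_nonneg_left h7 (by positivity)
  rw [← h1, h2]
  nlinarith

end Dissipation

/-! ### Robustness of exponential stability -/

section Exponential

variable {n : ℕ} {fbar : EuclideanSpace ℝ (Fin n) → ℝ → EuclideanSpace ℝ (Fin n)} {K : ℝ}

/-- Let `y` be the nominal trajectory from `z s`. As `‖y‖ ≤ D ‖z s‖`, the difference `z - y` grows
at rate at most `K + 1` (the 1 from `ε ≤ 1`) with forcing `ε D ‖z s‖ + 2U`, and Gronwall applies. -/
theorem norm_le_of_approxTrajectory_of_stabilityEstimate {D lam ε T t₀ s t U : ℝ}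
    {u z : ℝ → EuclideanSpace ℝ (Fin n)} (hK : 0 < K)
    (hF : Continuous fun p : EuclideanSpace ℝ (Fin n) × ℝ => fbar p.1 p.2)
    (hL : ∀ t x y, ‖fbar x t - fbar y t‖ ≤ K * ‖x - y‖) (hD : 1 < D) (hlam : 0 < lam)
    (hstab : StabilityEstimate fbar fun s t => D * s * Real.exp (-lam * t))
    (hε0 : 0 ≤ ε) (hε1 : ε ≤ 1) (ht₀ : 0 ≤ t₀)
    (hz : IsApproxTrajectory fbar t₀ z (fun t => ε * ‖z t‖ + 2 * ‖u t‖))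
    (hs : t₀ ≤ s) (hst : s ≤ t) (htT : t - s ≤ T) (hU0 : 0 ≤ U)
    (hU : ∀ᵐ r, r ∈ Icc s t → ‖u r‖ ≤ U) :
    ‖z t‖ ≤ D * ‖z s‖ * Real.exp (-lam * (t - s)) +
      (ε * (D * ‖z s‖) + 2 * U) * T * Real.exp ((K + 1) * T) := by
  have hs0 : 0 ≤ s := ht₀.trans hs
  obtain ⟨y, hy⟩ := (isForwardComplete_of_lipschitz hK hF hL s (z s) hs0).1
  have hyb := hstab s (z s) y hs0 hy
  have hyc := (isTrajectory_iff_isControlledTrajectory hF).1 hy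
  obtain ⟨L₁, hL₁⟩ := hyc.exists_lipschitzOnWith hF hs0 IsInput.zero t
  obtain ⟨L₂, hL₂⟩ := hz.1 t
  have hlip := (hL₂.mono (Icc_subset_Icc_left hs)).sub hL₁
  have hT0 : 0 ≤ t - s := sub_nonneg.2 hst
  have hexp : ∀ r, s ≤ r → Real.exp (-lam * (r - s)) ≤ 1 := fun r hr =>
    Real.exp_le_one_iff.2 (by nlinarith)
  have hDz : 0 ≤ D * ‖z s‖ := by positivity
  have he := norm_le_mul_exp_of_ae_norm_deriv_le (κ := K + 1)
    (B := ε * (D * ‖z s‖) + 2 * U) hst (by linarith) (by positivity) hlip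
    (by simp [hy.1]) (by
    filter_upwards [hz.2, hyc.ae_hasDerivAt, hU] with r hzr hyr hUr hrI
    obtain ⟨d, hd, hdb⟩ := hzr (hs.trans_lt hrI.1)
    have hyd := hyr hrI.1
    rw [add_zero] at hyd
    refine ⟨d - fbar (y r) r, hd.sub hyd, ?_⟩
    have h1 : ‖y r‖ ≤ D * ‖z s‖ := (hyb r hrI.1.le).trans
      (mul_le_of_le_one_right hDz (hexp r hrI.1.le))
    have h2 : ‖z r‖ ≤ ‖z r - y r‖ + ‖y r‖ := by
      have := norm_add_le (z r - y r) (y r)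
      rwa [sub_add_cancel] at this
    have h3 : ‖d - fbar (y r) r‖ ≤ ‖d - fbar (z r) r‖ + ‖fbar (z r) r - fbar (y r) r‖ :=
      norm_sub_le_norm_sub_add_norm_sub _ _ _
    have h4 := hL r (z r) (y r)
    have h5 := hUr (Ioo_subset_Icc_self hrI)
    have h6 : ε * ‖z r‖ ≤ ε * (‖z r - y r‖ + D * ‖z s‖) :=
      mul_le_mul_of_nonneg_left (by linarith) hε0
    have h7 : ε * ‖z r - y r‖ ≤ ‖z r - y r‖ := mul_le_of_le_one_left (norm_nonneg _) hε1
    change ‖d - fbar (y r) r‖ ≤ (K + 1) * ‖z r - y r‖ + _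
    linarith)
  have h1 : ‖z t‖ ≤ ‖y t‖ + ‖z t - y t‖ := by
    have := norm_add_le (y t) (z t - y t)
    rwa [add_sub_cancel] at this
  have h2 := hyb t hst
  refine h1.trans (add_le_add h2 (he.trans ?_))
  have h3 : Real.exp ((K + 1) * (t - s)) ≤ Real.exp ((K + 1) * T) :=
    Real.exp_le_exp.2 (mul_le_mul_of_nonneg_left htT (by linarith))
  have h4 : (ε * (D * ‖z s‖) + 2 * U) * (t - s) ≤ (ε * (D * ‖z s‖) + 2 * U) * T :=
    mul_le_mul_of_nonneg_left htT (by positivity)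
  have hT : 0 ≤ T := hT0.trans htT
  exact mul_le_mul h4 h3 (Real.exp_pos _).le (by positivity)

/-- Over a window of length `T` the nominal decay and the perturbation each contribute a factor at
most 1/4, so `‖z‖` is halved, up to an input term. -/
theorem exists_exponential_estimate_of_approxTrajectory (hK : 0 < K)
    (hF : Continuous fun p : EuclideanSpace ℝ (Fin n) × ℝ => fbar p.1 p.2)
    (hL : ∀ t x y, ‖fbar x t - fbar y t‖ ≤ K * ‖x - y‖) (hUGES : IsUGES fbar) :
    ∃ ε₀ D lam C : ℝ, 0 < ε₀ ∧ 1 < D ∧ 0 < lam ∧ 0 < C ∧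
      ∀ (t₀ : ℝ) (u z : ℝ → EuclideanSpace ℝ (Fin n)), 0 ≤ t₀ → IsInput u →
        IsApproxTrajectory fbar t₀ z (fun t => ε₀ * ‖z t‖ + 2 * ‖u t‖) → ∀ t, t₀ ≤ t →
          ‖z t‖ ≤ D * ‖z t₀‖ * Real.exp (-lam * (t - t₀)) + C * essNorm u t₀ t := by
  obtain ⟨-, D, lam, hD, hlam, hstab⟩ := hUGES
  obtain ⟨T, hTD, hT⟩ : ∃ T, D * Real.exp (-lam * T) ≤ 1 / 4 ∧ 0 < T := by
    have h1 : Tendsto (fun T => D * Real.exp (-lam * T)) atTop (𝓝 0) := by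
      have h2 : Tendsto (fun T => -lam * T) atTop atBot :=
        tendsto_id.const_mul_atTop_of_neg (by linarith)
      simpa using (Real.tendsto_exp_atBot.comp h2).const_mul D
    exact ((h1.eventually_le_const (by norm_num)).and (eventually_gt_atTop 0)).exists
  set E := Real.exp ((K + 1) * T) with hE
  have hE0 : 0 < E := Real.exp_pos _
  have hD0 : 0 < D := by linarith
  set ε₀ := min 1 (1 / (4 * D * T * E)) with hε₀
  have hε0 : 0 < ε₀ := lt_min one_pos (by positivity)
  have hε1 : ε₀ ≤ 1 := min_le_left _ _
  have hε2 : ε₀ * (D * T * E) ≤ 1 / 4 := by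
    calc ε₀ * (D * T * E) ≤ 1 / (4 * D * T * E) * (D * T * E) :=
          mul_le_mul_of_nonneg_right (min_le_right _ _) (by positivity)
      _ = 1 / 4 := by field_simp
  -- Halving per window gives the rate `log 2 / T`. The last, incomplete window costs `D + 1`, and
  -- rounding down the number of windows costs 2.
  refine ⟨ε₀, 2 * (D + 1), Real.log 2 / T, (D + 1) * (4 * T * E) + 2 * T * E, hε0, by linarith,
    div_pos (Real.log_pos (by norm_num)) hT, by positivity, ?_⟩
  intro t₀ u z ht₀ hu hz t ht
  set U := essNorm u t₀ t with hU
  have hU0 : 0 ≤ U := ENNReal.toReal_nonneg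
  have hwin : ∀ s r, t₀ ≤ s → s ≤ r → r ≤ t → r - s ≤ T →
      ‖z r‖ ≤ D * ‖z s‖ * Real.exp (-lam * (r - s)) + (1 / 4 * ‖z s‖ + 2 * T * E * U) := by
    intro s r hs hsr hrt hrT
    have h1 := norm_le_of_approxTrajectory_of_stabilityEstimate hK hF hL hD hlam hstab hε0.le hε1
      ht₀ hz hs hsr hrT hU0 (by
        filter_upwards [hu.ae_norm_le_essNorm (b := t) ht₀] with q hq hqI
        exact hq ⟨hs.trans hqI.1, hqI.2.trans hrt⟩)
    have h2 := mul_le_mul_of_nonneg_right hε2 (norm_nonneg (z s))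
    rw [← hE] at h1
    linarith
  -- `4TEU` is the fixed point of `b ↦ b/2 + 2TEU`.
  have hstep : ∀ k : ℕ, t₀ + k * T ≤ t →
      ‖z (t₀ + k * T)‖ ≤ (1 / 2) ^ k * ‖z t₀‖ + 4 * T * E * U := by
    intro k
    induction k with
    | zero =>
      intro _
      have : 0 ≤ 4 * T * E * U := by positivity
      simpa using this
    | succ k ih =>
      intro hk
      push_cast at hk ⊢
      have hk0 : 0 ≤ (k : ℝ) * T := by positivity
      have h1 := ih (by linarith)
      have h2 := hwin (t₀ + k * T) (t₀ + (k + 1) * T) (by linarith) (by linarith) hk (by linarith)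
      have h3 : t₀ + (k + 1) * T - (t₀ + k * T) = T := by ring
      rw [h3] at h2
      have h4 := mul_le_mul_of_nonneg_right hTD (norm_nonneg (z (t₀ + k * T)))
      rw [pow_succ]
      linarith
  set k := ⌊(t - t₀) / T⌋₊ with hk
  have hk1 : (k : ℝ) * T ≤ t - t₀ := by
    rw [← le_div_iff₀ hT]
    exact Nat.floor_le (div_nonneg (sub_nonneg.2 ht) hT.le)
  have hk2 : (t - t₀) / T < k + 1 := Nat.lt_floor_add_one _
  have hk3 : t - t₀ < (k + 1) * T := (div_lt_iff₀ hT).1 hk2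
  have hk0 : 0 ≤ (k : ℝ) * T := by positivity
  have h1 := hstep k (by linarith)
  have h2 := hwin (t₀ + k * T) t (by linarith) (by linarith) le_rfl (by linarith)
  have h3 : Real.exp (-lam * (t - (t₀ + k * T))) ≤ 1 :=
    Real.exp_le_one_iff.2 (by nlinarith)
  have h4 : D * ‖z (t₀ + k * T)‖ * Real.exp (-lam * (t - (t₀ + k * T))) ≤
      D * ‖z (t₀ + k * T)‖ := mul_le_of_le_one_right (by positivity) h3
  have h5 : ‖z t‖ ≤ (D + 1) * ‖z (t₀ + k * T)‖ + 2 * T * E * U := by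
    linarith [norm_nonneg (z (t₀ + k * T))]
  have h6 : (1 / 2 : ℝ) ^ k ≤ 2 * Real.exp (-(Real.log 2 / T) * (t - t₀)) := by
    have h7 : (1 / 2 : ℝ) ^ (k + 1) ≤ Real.exp (-(Real.log 2 / T) * (t - t₀)) := by
      have h8 : (1 / 2 : ℝ) = Real.exp (-Real.log 2) := by
        rw [Real.exp_neg, Real.exp_log (by norm_num)]; norm_num
      rw [h8, ← Real.exp_nat_mul]
      refine Real.exp_le_exp.2 ?_
      have h9 : Real.log 2 / T * (t - t₀) = Real.log 2 * ((t - t₀) / T) := by ring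
      have h10 := mul_le_mul_of_nonneg_left hk2.le (Real.log_pos (by norm_num : (1 : ℝ) < 2)).le
      push_cast
      linarith
    rw [pow_succ] at h7
    linarith
  have h7 := mul_le_mul_of_nonneg_right h6 (norm_nonneg (z t₀))
  have h8 := mul_le_mul_of_nonneg_left (h1.trans (add_le_add h7 le_rfl))
    (by linarith : (0 : ℝ) ≤ D + 1)
  linarith

end Exponential

/-! ### Stability without input from stability with input -/

section ZeroInput

variable {n : ℕ} {F : EuclideanSpace ℝ (Fin n) → ℝ → EuclideanSpace ℝ (Fin n)}

theorem essNorm_zero {m : ℕ} (a b : ℝ) :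
    essNorm (fun _ : ℝ => (0 : EuclideanSpace ℝ (Fin m))) a b = 0 := by
  rw [essNorm, eLpNorm_zero', ENNReal.toReal_zero]

theorem IsIISS.isUGAS (hFC : IsForwardComplete F)
    (hF : Continuous fun p : EuclideanSpace ℝ (Fin n) × ℝ => F p.1 p.2)
    (h : IsIISS fun x t (u : EuclideanSpace ℝ (Fin n)) => F x t + u) : IsUGAS F := by
  obtain ⟨-, μ, γ, β, hμ, hγ, hβ, hest⟩ := h
  obtain ⟨ν, hν, hμν⟩ := hμ.exists_inverse
  refine ⟨hFC, _, hβ.comp hν .id, fun t₀ x₀ x ht₀ hx t ht => ?_⟩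
  have h1 := hest t₀ x₀ (fun _ => 0) x ht₀ IsInput.zero
    ((isTrajectory_iff_isControlledTrajectory hF).1 hx) t ht
  simp only [norm_zero, hγ.map_zero, intervalIntegral.integral_zero, add_zero] at h1
  have h2 := hν.monotoneOn (mem_Ici.2 (hμ.nonneg (norm_nonneg _)))
    (mem_Ici.2 ((hβ.classKInfty _ (sub_nonneg.2 ht)).nonneg (norm_nonneg _))) h1
  rwa [(hμν _ (norm_nonneg _)).2] at h2

theorem IsISES.isUGES (hFC : IsForwardComplete F)
    (hF : Continuous fun p : EuclideanSpace ℝ (Fin n) × ℝ => F p.1 p.2)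
    (h : IsISES fun x t (u : EuclideanSpace ℝ (Fin n)) => F x t + u) : IsUGES F := by
  obtain ⟨-, γ, D, lam, hγ, hD, hlam, hest⟩ := h
  refine ⟨hFC, D, lam, hD, hlam, fun t₀ x₀ x ht₀ hx t ht => ?_⟩
  have h1 := hest t₀ x₀ (fun _ => 0) x ht₀ IsInput.zero
    ((isTrajectory_iff_isControlledTrajectory hF).1 hx) t ht
  rwa [essNorm_zero, hγ.map_zero, add_zero] at h1

end ZeroInput

/-! ### Rapidly time-varying systems -/

section Rapid

variable {n : ℕ} {f : EuclideanSpace ℝ (Fin n) → ℝ → ℝ → EuclideanSpace ℝ (Fin n)}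
  {fbar : EuclideanSpace ℝ (Fin n) → ℝ → EuclideanSpace ℝ (Fin n)}
  {δ N : ℝ → ℝ} {η₀ K c : ℝ}

/-- With `η = √α`, the window `h = 2/η` is the one in the averaging hypothesis, so the mean of `p`
is at most `(η N(η) / 2) δ(|x|/2)`. All smallness conditions hold for large `η`. -/
theorem exists_approxTrajectory_of_rapid (hδ : IsClassK δ)
    (hlin : ∀ s, 0 ≤ s → δ s ≤ c * s) (hN : IsClassM N) (hK : 0 < K)
    (hf_time : ∀ α : ℝ, 0 < α → ∀ x, Continuous fun t : ℝ => f x t (α * t))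
    (hfbar_time : ∀ x, Continuous fun t : ℝ => fbar x t)
    (hfL : ∀ α : ℝ, 0 < α → ∀ t x y, ‖f x t (α * t) - f y t (α * t)‖ ≤ K * ‖x - y‖)
    (hfbarL : ∀ t x y, ‖fbar x t - fbar y t‖ ≤ K * ‖x - y‖)
    (hf_growth : ∀ α : ℝ, 0 < α → ∀ x t, ‖f x t (α * t)‖ ≤ δ (‖x‖ / 2))
    (hfbar_growth : ∀ x t, ‖fbar x t‖ ≤ δ (‖x‖ / 2))
    (hrelate : ∀ η : ℝ, η₀ ≤ η → ∀ (x : EuclideanSpace ℝ (Fin n)) (r : ℝ),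
      ‖∫ l in (r - 1 / η)..(r + 1 / η), (f x l (η ^ 2 * l) - fbar x l)‖ ≤ δ (‖x‖ / 2) * N η)
    {ε : ℝ} (hε : 0 < ε) :
    ∃ α₀ : ℝ, 0 < α₀ ∧ ∀ α, α₀ ≤ α → ∀ (t₀ : ℝ) (x₀ : EuclideanSpace ℝ (Fin n))
      (u x : ℝ → EuclideanSpace ℝ (Fin n)), 0 ≤ t₀ → IsInput u →
      IsControlledTrajectory (fun x t (u : EuclideanSpace ℝ (Fin n)) => f x t (α * t) + u)
        t₀ x₀ u x →
      ∃ z : ℝ → EuclideanSpace ℝ (Fin n),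
        IsApproxTrajectory fbar t₀ z (fun t => ε * δ ‖z t‖ + 2 * ‖u t‖) ∧
        ∀ t, ‖x t‖ ≤ 2 * ‖z t‖ ∧ ‖z t‖ ≤ 2 * ‖x t‖ := by
  have hinv : ∀ b : ℝ, Tendsto (fun η : ℝ => b / η) atTop (𝓝 0) := fun b =>
    tendsto_const_nhds.div_atTop tendsto_id
  have hεlim : Tendsto (fun η : ℝ => η * N η / 2 + 8 * K / η) atTop (𝓝 0) := by
    simpa using (hN.tendsto_zero.div_const 2).add (hinv (8 * K))
  obtain ⟨H, hH⟩ := eventually_atTop.1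
    (((hεlim.eventually_le_const hε).and
      ((hinv (4 * K)).eventually_le_const one_pos)).and
      (((hinv (2 * c)).eventually_le_const (show (0 : ℝ) < 1 / 2 by norm_num)).and
        ((eventually_ge_atTop η₀).and (eventually_ge_atTop 1))))
  refine ⟨max H 1 ^ 2, by positivity, ?_⟩
  intro α hα t₀ x₀ u x ht₀ hu hx
  have hα0 : 0 < α := lt_of_lt_of_le (by positivity) hα
  set η := Real.sqrt α with hη
  have hηα : η ^ 2 = α := Real.sq_sqrt hα0.le
  have hHη : H ≤ η := (le_max_left _ _).trans (Real.le_sqrt_of_sq_le hα)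
  obtain ⟨⟨h1, h2⟩, h3, h4, h5⟩ := hH η hHη
  have hη0 : 0 < η := by linarith
  set h := 2 / η with hh
  have hh0 : 0 < h := by positivity
  have hhK : 2 * K * h ≤ 1 := by
    have : 2 * K * h = 4 * K / η := by rw [hh]; ring
    rwa [this]
  have hhc : h * c ≤ 1 / 2 := by
    have : h * c = 2 * c / η := by rw [hh]; ring
    rwa [this]
  have hN0 : 0 ≤ η * N η / 2 := by
    have := hN.nonneg η hη0.le
    positivity
  have havg : ∀ x t, ‖h⁻¹ • ∫ l in (t - h)..t, (f x l (α * l) - fbar x l)‖ ≤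
      η * N η / 2 * δ (‖x‖ / 2) := by
    intro x t
    -- Centring at `t - 1/η` makes the symmetric window equal to `[t-h, t]`.
    have h6 := hrelate η h4 x (t - 1 / η)
    have h7 : t - 1 / η - 1 / η = t - h := by rw [hh]; ring
    rw [h7, sub_add_cancel, hηα] at h6
    rw [norm_smul, norm_inv, Real.norm_of_nonneg hh0.le, hh, inv_div]
    calc η / 2 * _ ≤ η / 2 * (δ (‖x‖ / 2) * N η) :=
          mul_le_mul_of_nonneg_left h6 (by positivity)
      _ = _ := by ring
  set g : EuclideanSpace ℝ (Fin n) → ℝ → EuclideanSpace ℝ (Fin n) :=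
    fun x t => f x t (α * t) with hg
  have hz := isApproxTrajectory_averagingShift (g := g) hδ hlin (hf_time α hα0) hfbar_time
    (hfL α hα0) hfbarL (hf_growth α hα0) hfbar_growth hK hh0 hhK hhc havg hN0 ht₀ hu hx
  refine ⟨_, ⟨hz.1, ?_⟩, fun t => ?_⟩
  · filter_upwards [hz.2] with t ht htt
    obtain ⟨d, hd, hdb⟩ := ht htt
    refine ⟨d, hd, hdb.trans ?_⟩
    have h6 : η * N η / 2 + 4 * K * h ≤ ε := by
      have : 4 * K * h = 8 * K / η := by rw [hh]; ring
      rwa [this]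
    exact add_le_add (mul_le_mul_of_nonneg_right h6 (hδ.nonneg (norm_nonneg _))) le_rfl
  · have h6 := norm_averagingShift_le_half hh0 hlin (hf_growth α hα0) hfbar_growth hhc (x t) t
    have h7 := norm_add_le (x t) (averagingShift (fun x t => g x t - fbar x t) h (x t) t)
    have h8 := norm_sub_le_norm_add (x t)
      (averagingShift (fun x t => g x t - fbar x t) h (x t) t)
    have h9 := norm_nonneg (x t)
    exact ⟨by linarith, by linarith⟩

end Rapid

/-! ### From approximate trajectories to iISS and ISS -/

section InputEstimates

variable {n : ℕ} {F fbar : EuclideanSpace ℝ (Fin n) → ℝ → EuclideanSpace ℝ (Fin n)}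
  {V : EuclideanSpace ℝ (Fin n) → ℝ → ℝ} {δ δ₁ δ₂ : ℝ → ℝ} {c ε : ℝ}

theorem isIISS_of_approxTrajectory
    (hFC : IsControlForwardComplete fun x t (u : EuclideanSpace ℝ (Fin n)) => F x t + u)
    (hc : 0 < c) (hδ : IsClassK δ)
    (hV : ContDiffOn ℝ 1 (fun p : EuclideanSpace ℝ (Fin n) × ℝ => V p.1 p.2) (univ ×ˢ Ici 0))
    (hδ₁ : IsClassKInfty δ₁) (hδ₂ : IsClassKInfty δ₂)
    (hVb : ∀ ξ t, 0 ≤ t → δ₁ ‖ξ‖ ≤ V ξ t ∧ V ξ t ≤ δ₂ ‖ξ‖)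
    (hdecay : ∀ ξ t, 0 ≤ t →
      timeDeriv V ξ t + spaceDeriv V ξ t (fbar ξ t) ≤ -c * δ ‖ξ‖ ^ 2)
    (hgrad : ∀ ξ t, 0 ≤ t → ‖spaceDeriv V ξ t‖ ≤ δ ‖ξ‖) (hε : ε ≤ c / 2)
    (hz : ∀ (t₀ : ℝ) (x₀ : EuclideanSpace ℝ (Fin n)) (u x : ℝ → EuclideanSpace ℝ (Fin n)),
      0 ≤ t₀ → IsInput u →
      IsControlledTrajectory (fun x t (u : EuclideanSpace ℝ (Fin n)) => F x t + u) t₀ x₀ u x →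
      ∃ z : ℝ → EuclideanSpace ℝ (Fin n),
        IsApproxTrajectory fbar t₀ z (fun t => ε * δ ‖z t‖ + 2 * ‖u t‖) ∧
        ∀ t, ‖x t‖ ≤ 2 * ‖z t‖ ∧ ‖z t‖ ≤ 2 * ‖x t‖) :
    IsIISS fun x t (u : EuclideanSpace ℝ (Fin n)) => F x t + u := by
  obtain ⟨δ₂', hδ₂', hinv⟩ := hδ₂.exists_inverse
  have hσ : IsClassK fun s => c / 4 * δ (δ₂' s) ^ 2 :=
    (hδ.comp hδ₂'.toIsClassK).const_mul_sq (by positivity)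
  obtain ⟨β, hβ, hσβ⟩ := hσ.exists_decay_classKL
  have hV0 : ∀ ξ t, 0 ≤ t → 0 ≤ V ξ t := fun ξ t ht =>
    (hδ₁.nonneg (norm_nonneg ξ)).trans (hVb ξ t ht).1
  refine ⟨hFC, fun s => δ₁ (1 / 2 * s), fun r => 4 / c * r ^ 2, fun s t => β (δ₂ (2 * s)) t,
    hδ₁.comp (IsClassKInfty.id.const_mul (by norm_num)),
    IsClassKInfty.id.const_mul_sq (by positivity),
    hβ.comp .id (hδ₂.comp (IsClassKInfty.id.const_mul two_pos)), ?_⟩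
  intro t₀ x₀ u x ht₀ hu hx t ht
  obtain ⟨z, hza, hzx⟩ := hz t₀ x₀ u x ht₀ hu hx
  have hx0 : x t₀ = x₀ := by simpa using (hx t₀ le_rfl).2
  have ht0 : 0 ≤ t := ht₀.trans ht
  have hd := ae_hasDerivAt_lyapunov_le hc hδ hV hδ₂'.toIsClassK (fun s hs => (hinv s hs).2) hV0
    (fun ξ t ht => (hVb ξ t ht).2) hdecay hgrad ht₀ hε hza
  have hui : IntervalIntegrable (fun s => 4 / c * ‖u s‖ ^ 2) volume t₀ t := by
    rw [intervalIntegrable_iff_integrableOn_Icc_of_le ht]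
    have h2 : MemLp u 2 (volume.restrict (Icc t₀ t)) :=
      ((hu t).mono_measure (Measure.restrict_mono (Icc_subset_Icc_left ht₀) le_rfl)).mono_exponent
        le_top
    exact (h2.integrable_norm_pow two_ne_zero).const_mul _
  have h1 := le_add_integral_of_ae_hasDerivAt_le hσ hβ hσβ ht
    (absolutelyContinuousOnInterval_comp_approxTrajectory hV ht₀ hza ht) (hV0 _ _ ht₀) hui
    (fun s => by positivity) (hd.mono fun s hs hsI => hs hsI.1)
  have h2 : δ₁ (1 / 2 * ‖x t‖) ≤ V (z t) t :=
    (hδ₁.monotoneOn (mem_Ici.2 (by positivity)) (mem_Ici.2 (norm_nonneg _))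
      (by linarith [(hzx t).1])).trans (hVb (z t) t ht0).1
  have h3 : V (z t₀) t₀ ≤ δ₂ (2 * ‖x₀‖) :=
    (hVb (z t₀) t₀ ht₀).2.trans (hδ₂.monotoneOn (mem_Ici.2 (norm_nonneg _))
      (mem_Ici.2 (by positivity)) (by rw [← hx0]; exact (hzx t₀).2))
  have h4 : β (V (z t₀) t₀) (t - t₀) ≤ β (δ₂ (2 * ‖x₀‖)) (t - t₀) :=
    (hβ.classKInfty _ (sub_nonneg.2 ht)).monotoneOn (hV0 _ _ ht₀) ((hV0 _ _ ht₀).trans h3) h3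
  linarith

/-- Unboundedness of `δ` makes `σ` of class `K_∞`, so the level `w = σ⁻¹(2B)` exists for inputs of
any size. -/
theorem isISS_of_approxTrajectory
    (hFC : IsControlForwardComplete fun x t (u : EuclideanSpace ℝ (Fin n)) => F x t + u)
    (hc : 0 < c) (hδ : IsClassKInfty δ)
    (hV : ContDiffOn ℝ 1 (fun p : EuclideanSpace ℝ (Fin n) × ℝ => V p.1 p.2) (univ ×ˢ Ici 0))
    (hδ₁ : IsClassKInfty δ₁) (hδ₂ : IsClassKInfty δ₂)
    (hVb : ∀ ξ t, 0 ≤ t → δ₁ ‖ξ‖ ≤ V ξ t ∧ V ξ t ≤ δ₂ ‖ξ‖)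
    (hdecay : ∀ ξ t, 0 ≤ t →
      timeDeriv V ξ t + spaceDeriv V ξ t (fbar ξ t) ≤ -c * δ ‖ξ‖ ^ 2)
    (hgrad : ∀ ξ t, 0 ≤ t → ‖spaceDeriv V ξ t‖ ≤ δ ‖ξ‖) (hε : ε ≤ c / 2)
    (hz : ∀ (t₀ : ℝ) (x₀ : EuclideanSpace ℝ (Fin n)) (u x : ℝ → EuclideanSpace ℝ (Fin n)),
      0 ≤ t₀ → IsInput u →
      IsControlledTrajectory (fun x t (u : EuclideanSpace ℝ (Fin n)) => F x t + u) t₀ x₀ u x →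
      ∃ z : ℝ → EuclideanSpace ℝ (Fin n),
        IsApproxTrajectory fbar t₀ z (fun t => ε * δ ‖z t‖ + 2 * ‖u t‖) ∧
        ∀ t, ‖x t‖ ≤ 2 * ‖z t‖ ∧ ‖z t‖ ≤ 2 * ‖x t‖) :
    IsISS fun x t (u : EuclideanSpace ℝ (Fin n)) => F x t + u := by
  obtain ⟨δ₁', hδ₁', hinv₁⟩ := hδ₁.exists_inverse
  obtain ⟨δ₂', hδ₂', hinv⟩ := hδ₂.exists_inverse
  have hσ : IsClassKInfty fun s => c / 4 * δ (δ₂' s) ^ 2 :=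
    (hδ.comp hδ₂').const_mul_sq (by positivity)
  obtain ⟨τ, hτ, hστ⟩ := hσ.exists_inverse
  obtain ⟨β, hβ, hσβ⟩ := (hσ.const_mul (c := 1 / 2) (by norm_num)).exists_decay_classKL
  have hV0 : ∀ ξ t, 0 ≤ t → 0 ≤ V ξ t := fun ξ t ht =>
    (hδ₁.nonneg (norm_nonneg ξ)).trans (hVb ξ t ht).1
  have hν : IsClassKInfty fun r => 2 * δ₁' (2 * r) :=
    (hδ₁'.comp (IsClassKInfty.id.const_mul two_pos)).const_mul two_pos
  refine ⟨hFC, fun r => 2 * δ₁' (2 * τ (2 * (4 / c * r ^ 2))),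
    fun s t => 2 * δ₁' (2 * β (δ₂ (2 * s)) t),
    hν.comp (hτ.comp ((IsClassKInfty.id.const_mul_sq (by positivity)).const_mul two_pos)),
    hβ.comp hν (hδ₂.comp (IsClassKInfty.id.const_mul two_pos)), ?_⟩
  intro t₀ x₀ u x ht₀ hu hx t ht
  obtain ⟨z, hza, hzx⟩ := hz t₀ x₀ u x ht₀ hu hx
  have hx0 : x t₀ = x₀ := by simpa using (hx t₀ le_rfl).2
  have ht0 : 0 ≤ t := ht₀.trans ht
  have hd := ae_hasDerivAt_lyapunov_le hc hδ.toIsClassK hV hδ₂'.toIsClassK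
    (fun s hs => (hinv s hs).2) hV0 (fun ξ t ht => (hVb ξ t ht).2) hdecay hgrad ht₀ hε hza
  set U := essNorm u t₀ t with hU
  set w := τ (2 * (4 / c * U ^ 2)) with hw
  have hB : 0 ≤ 2 * (4 / c * U ^ 2) := by positivity
  have hw0 : 0 ≤ w := hτ.nonneg hB
  have h1 := le_add_of_ae_hasDerivAt_le_add_const hσ.toIsClassK hβ hσβ ht
    (absolutelyContinuousOnInterval_comp_approxTrajectory hV ht₀ hza ht) (hV0 _ _ ht₀) hw0
    (hστ _ hB).1 (by
      filter_upwards [hd, hu.ae_norm_le_essNorm (b := t) ht₀] with s hs hus hsI d hds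
      have h2 := hs hsI.1 d hds
      have h3 := pow_le_pow_left₀ (norm_nonneg _) (hus (Ioo_subset_Icc_self hsI)) 2
      have h4 := mul_le_mul_of_nonneg_left h3 (by positivity : 0 ≤ 4 / c)
      linarith)
  have h3 : V (z t₀) t₀ ≤ δ₂ (2 * ‖x₀‖) :=
    (hVb (z t₀) t₀ ht₀).2.trans (hδ₂.monotoneOn (mem_Ici.2 (norm_nonneg _))
      (mem_Ici.2 (by positivity)) (by rw [← hx0]; exact (hzx t₀).2))
  have hβK := hβ.classKInfty _ (sub_nonneg.2 ht)
  have h4 : β (V (z t₀) t₀) (t - t₀) ≤ β (δ₂ (2 * ‖x₀‖)) (t - t₀) :=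
    hβK.monotoneOn (hV0 _ _ ht₀) ((hV0 _ _ ht₀).trans h3) h3
  have hb0 : 0 ≤ β (δ₂ (2 * ‖x₀‖)) (t - t₀) := hβK.nonneg ((hV0 _ _ ht₀).trans h3)
  set b := β (δ₂ (2 * ‖x₀‖)) (t - t₀) with hb
  have h5 : δ₁ ‖z t‖ ≤ b + w := (hVb (z t) t ht0).1.trans (by linarith)
  have hmono : ∀ p q, 0 ≤ p → p ≤ q → δ₁' p ≤ δ₁' q := fun p q hp hpq =>
    hδ₁'.monotoneOn hp (hp.trans hpq) hpq
  have h6 : ‖z t‖ ≤ δ₁' (b + w) := by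
    have := hmono _ _ (hδ₁.nonneg (norm_nonneg _)) h5
    rwa [(hinv₁ _ (norm_nonneg _)).2] at this
  -- Weak triangle inequality: `b + w` is at most twice the larger term.
  have h7 : δ₁' (b + w) ≤ δ₁' (2 * b) + δ₁' (2 * w) := by
    have h8 := hδ₁'.nonneg (by positivity : 0 ≤ 2 * b)
    have h9 := hδ₁'.nonneg (by positivity : 0 ≤ 2 * w)
    rcases le_total b w with hbw | hbw
    · linarith [hmono (b + w) (2 * w) (by positivity) (by linarith)]
    · linarith [hmono (b + w) (2 * b) (by positivity) (by linarith)]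
  linarith [(hzx t).1]

end InputEstimates

end TimeVarying

theorem mainTheorem1 {n : ℕ}
    (f : EuclideanSpace ℝ (Fin n) → ℝ → ℝ → EuclideanSpace ℝ (Fin n))
    (fbar : EuclideanSpace ℝ (Fin n) → ℝ → EuclideanSpace ℝ (Fin n))
    (δ N : ℝ → ℝ) (η₀ K : ℝ)
    (hf_time : ∀ α : ℝ, 0 < α → ∀ x, Continuous fun t : ℝ => f x t (α * t))
    (hf_space : ∀ α : ℝ, 0 < α → ∀ t : ℝ, ContDiff ℝ 1 fun x => f x t (α * t))
    (hfbar_time : ∀ x, Continuous fun t : ℝ => fbar x t)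
    (hfbar_space : ∀ t : ℝ, ContDiff ℝ 1 fun x => fbar x t)
    (hδ : TimeVarying.IsClassK δ)
    (hcompat : TimeVarying.IsCompatible δ fbar)
    (hUGAS : TimeVarying.IsUGAS fbar)
    (hη₀ : 0 < η₀) (hK : 1 < K)
    (hN : TimeVarying.IsClassM N)
    (hrelate : ∀ η : ℝ, η₀ ≤ η → ∀ (x : EuclideanSpace ℝ (Fin n)) (r : ℝ),
      ‖∫ l in (r - 1 / η)..(r + 1 / η), (f x l (η ^ 2 * l) - fbar x l)‖ ≤ δ (‖x‖ / 2) * N η)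
    (hfbar_jac : ∀ x t, ‖fderiv ℝ (fun y => fbar y t) x‖ ≤ K)
    (hf_jac : ∀ α : ℝ, 0 < α → ∀ x t, ‖fderiv ℝ (fun y => f y t (α * t)) x‖ ≤ K)
    (hf_growth : ∀ α : ℝ, 0 < α → ∀ x t, ‖f x t (α * t)‖ ≤ δ (‖x‖ / 2)) :
    ∃ α₀ : ℝ, 0 < α₀ ∧
      (∀ α : ℝ, α₀ ≤ α →
        TimeVarying.IsUGAS (fun x t => f x t (α * t)) ∧
        TimeVarying.IsIISS (fun x t (u : EuclideanSpace ℝ (Fin n)) => f x t (α * t) + u)) ∧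
      (TimeVarying.IsClassKInfty δ → ∀ α : ℝ, α₀ ≤ α →
        TimeVarying.IsISS (fun x t (u : EuclideanSpace ℝ (Fin n)) => f x t (α * t) + u)) ∧
      (TimeVarying.IsUGES fbar → ∀ α : ℝ, α₀ ≤ α →
        TimeVarying.IsUGES (fun x t => f x t (α * t)) ∧
        TimeVarying.IsISES (fun x t (u : EuclideanSpace ℝ (Fin n)) => f x t (α * t) + u)) := by
  have hK0 : 0 < K := by linarith
  obtain ⟨V, hLyap, c₁, c₂, hc₁, -, hc₂, hdecay, hgrad, hfbar_growth, hlin⟩ := hcompat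
  obtain ⟨δ₁, δ₂, hδ₁, hδ₂, hVb⟩ := hLyap.bounds
  have hfL : ∀ α : ℝ, 0 < α → ∀ t x y, ‖f x t (α * t) - f y t (α * t)‖ ≤ K * ‖x - y‖ :=
    fun α hα => TimeVarying.norm_sub_le_of_norm_fderiv_le (hf_space α hα) (hf_jac α hα)
  have hfbarL := TimeVarying.norm_sub_le_of_norm_fderiv_le hfbar_space hfbar_jac
  have hfbarc := TimeVarying.continuous_uncurry_of_lipschitz hfbar_time hfbarL
  have hfc := fun (α : ℝ) (hα : 0 < α) =>
    TimeVarying.continuous_uncurry_of_lipschitz (hf_time α hα) (hfL α hα)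
  have hrapid := fun {ε : ℝ} (hε : 0 < ε) =>
    TimeVarying.exists_approxTrajectory_of_rapid hδ hlin hN hK0 hf_time hfbar_time hfL
      hfbarL hf_growth hfbar_growth hrelate hε
  obtain ⟨α₁, hα₁, h₁⟩ := hrapid (half_pos hc₁)
  -- The threshold must be fixed before UGES is assumed, hence the case split with an arbitrary
  -- value when it fails.
  obtain ⟨α₂, h₂⟩ : ∃ α₂ : ℝ, TimeVarying.IsUGES fbar → ∀ α : ℝ, 0 < α → α₂ ≤ α →
      TimeVarying.IsISES (fun x t (u : EuclideanSpace ℝ (Fin n)) => f x t (α * t) + u) := by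
    by_cases hU : TimeVarying.IsUGES fbar
    · obtain ⟨ε₀, D, lam, C, hε₀, hD, hlam, hC, hest⟩ :=
        TimeVarying.exists_exponential_estimate_of_approxTrajectory hK0 hfbarc hfbarL hU
      -- Since `δ s ≤ c₂ s`, the tolerance `ε₀ / c₂` yields an error at most `ε₀ ‖z‖`. The factor 4
      -- in `4 * D` comes from passing from `x` to `z` and back.
      obtain ⟨α₂, -, h₂⟩ := hrapid (div_pos hε₀ hc₂)
      refine ⟨α₂, fun _ α hα hα₂ => ⟨TimeVarying.isControlForwardComplete_of_lipschitz hK0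
        (hfc α hα) (hfL α hα), fun r => 2 * C * r, 4 * D, lam,
        TimeVarying.IsClassKInfty.id.const_mul (by positivity), by linarith, hlam, ?_⟩⟩
      intro t₀ x₀ u x ht₀ hu hx t ht
      obtain ⟨z, hz, hzx⟩ := h₂ α hα₂ t₀ x₀ u x ht₀ hu hx
      have hx0 : x t₀ = x₀ := by simpa using (hx t₀ le_rfl).2
      have h3 := hest t₀ u z ht₀ hu ⟨hz.1, by
        filter_upwards [hz.2] with s hs hts
        obtain ⟨d, hd, hdb⟩ := hs hts
        refine ⟨d, hd, hdb.trans (add_le_add ?_ le_rfl)⟩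
        have h4 := mul_le_mul_of_nonneg_left (hlin _ (norm_nonneg (z s)))
          (div_pos hε₀ hc₂).le
        rwa [← mul_assoc, div_mul_cancel₀ _ hc₂.ne'] at h4⟩ t ht
      have h4 := (hzx t₀).2
      rw [hx0] at h4
      have h5 : D * ‖z t₀‖ * Real.exp (-lam * (t - t₀)) ≤
          D * (2 * ‖x₀‖) * Real.exp (-lam * (t - t₀)) := by gcongr
      linarith [(hzx t).1]
    · exact ⟨0, fun h => absurd h hU⟩
  refine ⟨max α₁ α₂, lt_max_of_lt_left hα₁, fun α hα => ?_, fun hδ' α hα => ?_,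
    fun hU α hα => ?_⟩
  all_goals
    have hα' : α₁ ≤ α := (le_max_left _ _).trans hα
    have hα0 : 0 < α := hα₁.trans_le hα'
    have hCFC := TimeVarying.isControlForwardComplete_of_lipschitz hK0 (hfc α hα0) (hfL α hα0)
    have hFC := TimeVarying.isForwardComplete_of_lipschitz hK0 (hfc α hα0) (hfL α hα0)
  · have h := TimeVarying.isIISS_of_approxTrajectory hCFC hc₁ hδ hLyap.contDiffOn hδ₁ hδ₂ hVb
      hdecay hgrad le_rfl (h₁ α hα')
    exact ⟨h.isUGAS hFC (hfc α hα0), h⟩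
  · exact TimeVarying.isISS_of_approxTrajectory hCFC hc₁ hδ' hLyap.contDiffOn hδ₁ hδ₂ hVb
      hdecay hgrad le_rfl (h₁ α hα')
  · have h := h₂ hU α hα0 ((le_max_right _ _).trans hα)
    exact ⟨h.isUGES hFC (hfc α hα0), h⟩
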